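/- **Proposition (self-adjointness).** Let $N\ge 2$ and consider a star graph consisting of $N$ links of lengths $\ell_j\in(0,\infty]$, $j=1,\dots,N$, joined at a single vertex, the $j$-th link being identified with the interval $(0,\ell_j)$ and the vertex with its endpoint $0$. Let $\mathcal H:=\bigoplus_{j=1}^N L^2(0,\ell_j)$ (complex-valued functions), and let $V=\{V_j\}_{j=1}^N$ be real-valued potentials on the links such that * (p1) $V_j$ is locally integrable on its link up to the finite endpoints, i.e. $V_j$ is integrable over every bounded subinterval of $(0,\ell_j)$, $j=1,\dots,N$; * (p2) if $\ell_j=\infty$, the differential expression $-\frac{d^2}{dx^2}+V_j(x)$ is in the limit point case at infinity, i.e. there is no $z\in\mathbb C$ for which all solutions of $-u''+V_ju=zu$ on $(0,\infty)$ are square integrable near infinity; if $\ell_j<\infty$, a number $\omega_j\in\mathbb R$ is fixed. For $\alpha\in\mathbb R\cup\{\infty\}$ let $H_\alpha(V)$ be the operator in $\mathcal H$ acting as $$H_\alpha(V)\{\psi_j\}:=\{-\psi_j''+V_j\psi_j\},$$ whose domain consists of all $\{\psi_j\}\in\mathcal H$ such that, for every $j$, $\psi_j$ and $\psi_j'$ are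 locally absolutely continuous on $(0,\ell_j)$ and $-\psi_j''+V_j\psi_j\in L^2(0,\ell_j)$; at the end of every link with $\ell_j<\infty$ one has $$\psi_j(\ell_j)\cos\omega_j+\psi_j'(\ell_j)\sin\omega_j=0;$$ and at the vertex, if $\alpha\in\mathbb R$, $$\psi_1(0+)=\cdots=\psi_N(0+)=:\psi,\qquad \sum_{j=1}^N\psi_j'(0+)=\alpha\,\psi,$$ while if $\alpha=\infty$, $\psi_j(0+)=0$ for $j=1,\dots,N$. (Values at endpoints are one-sided limits, whose existence is part of the condition.) Then $H_\alpha(V)$ is self-adjoint for every $\alpha\in\mathbb R\cup\{\infty\}$. -/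

import Mathlib

open MeasureTheory Filter Topology Set

noncomputable section

namespace StarGraph

/-- The open link `(0, ℓ)`, where the length `ℓ` is a positive real number or `∞`. -/
def link (ℓ : EReal) : Set ℝ := {x : ℝ | 0 < x ∧ (x : EReal) < ℓ}

/-- The link together with its finite endpoints: `[0, ℓ]` if `ℓ < ∞` and `[0, ∞)` if `ℓ = ∞`. -/
def closedLink (ℓ : EReal) : Set ℝ := {x : ℝ | 0 ≤ x ∧ (x : EReal) ≤ ℓ}

lemma isOpen_link (ℓ : EReal) : IsOpen (link ℓ) :=
  (isOpen_lt continuous_const continuous_id).inter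
    (isOpen_lt continuous_coe_real_ereal continuous_const)

/-- On the open set `I`, the function `u` is continuously differentiable with derivative `w`, the
function `w = u'` is locally absolutely continuous, and `-u'' + V u = f` almost everywhere. -/
structure SolvesOn (I : Set ℝ) (V : ℝ → ℝ) (u w f : ℝ → ℂ) : Prop where
  hasDerivAt : ∀ x ∈ I, HasDerivAt u (w x) x
  absolutelyContinuous : ∀ a ∈ I, ∀ b ∈ I, AbsolutelyContinuousOnInterval w a b
  ae_eq : ∀ᵐ x ∂(volume.restrict I), HasDerivAt w ((V x : ℂ) * u x - f x) x

/-- The expression `-d²/dx² + V` is in the limit circle case at infinity: for some `z ∈ ℂ`, all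
solutions of `-u'' + V u = z u` are square integrable near infinity. -/
def IsLimitCircleAtInfinity (V : ℝ → ℝ) : Prop :=
  ∃ z : ℂ, ∀ u w : ℝ → ℂ, SolvesOn (Ioi 0) V u w (fun x => z * u x) →
    ∃ c > (0 : ℝ), MemLp u 2 (volume.restrict (Ioi c))

/-- The limit point case at infinity. -/
def IsLimitPointAtInfinity (V : ℝ → ℝ) : Prop := ¬ IsLimitCircleAtInfinity V

/-- The state space `⨁ j, L²(0, ℓ j)`. -/
abbrev StateSpace {N : ℕ} (ℓ : Fin N → EReal) : Type :=
  PiLp 2 (fun j : Fin N => Lp ℂ 2 (volume.restrict (link (ℓ j))))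

/-- The condition at the vertex, `u j` being the wave function on the `j`th link and `w j` its
derivative: for `α ∈ ℝ`, the boundary values `u j (0+)` exist and have a common value `c`, the
boundary values `w j (0+)` exist, and they sum up to `α c`; for `α = ∞`, the Dirichlet condition. -/
def VertexCondition {N : ℕ} (α : OnePoint ℝ) (u w : Fin N → ℝ → ℂ) : Prop :=
  (∀ a : ℝ, α = (a : OnePoint ℝ) → ∃ (c : ℂ) (d : Fin N → ℂ),
      (∀ j, Tendsto (u j) (𝓝[>] 0) (𝓝 c)) ∧ (∀ j, Tendsto (w j) (𝓝[>] 0) (𝓝 (d j))) ∧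
      ∑ j, d j = (a : ℂ) * c) ∧
  (α = OnePoint.infty → ∀ j, Tendsto (u j) (𝓝[>] 0) (𝓝 0))

/-- The condition `u(L) cos ω + u'(L) sin ω = 0` at the end of each link of finite length `L`. -/
def EndCondition {N : ℕ} (ℓ : Fin N → EReal) (ω : Fin N → ℝ) (u w : Fin N → ℝ → ℂ) : Prop :=
  ∀ (j : Fin N) (L : ℝ), ℓ j = (L : EReal) → ∃ c d : ℂ,
    Tendsto (u j) (𝓝[<] L) (𝓝 c) ∧ Tendsto (w j) (𝓝[<] L) (𝓝 d) ∧
    c * (Real.cos (ω j) : ℂ) + d * (Real.sin (ω j) : ℂ) = 0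

lemma SolvesOn.zero (I : Set ℝ) (V : ℝ → ℝ) : SolvesOn I V 0 0 0 where
  hasDerivAt x _ := hasDerivAt_const x 0
  absolutelyContinuous a _ b _ := by
    simp [AbsolutelyContinuousOnInterval, tendsto_const_nhds]
  ae_eq := by
    filter_upwards with x
    simp

lemma SolvesOn.add {I : Set ℝ} {V : ℝ → ℝ} {u w f u' w' f' : ℝ → ℂ}
    (h : SolvesOn I V u w f) (h' : SolvesOn I V u' w' f') :
    SolvesOn I V (u + u') (w + w') (f + f') where
  hasDerivAt x hx := (h.hasDerivAt x hx).add (h'.hasDerivAt x hx)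
  absolutelyContinuous a ha b hb :=
    (h.absolutelyContinuous a ha b hb).add (h'.absolutelyContinuous a ha b hb)
  ae_eq := by
    filter_upwards [h.ae_eq, h'.ae_eq] with x h1 h2
    have := h1.add h2
    rw [show ((V x : ℂ) * u x - f x) + ((V x : ℂ) * u' x - f' x) =
      (V x : ℂ) * (u + u') x - (f + f') x by simp only [Pi.add_apply]; ring] at this
    exact this

lemma SolvesOn.smul {I : Set ℝ} {V : ℝ → ℝ} {u w f : ℝ → ℂ} (k : ℂ) (h : SolvesOn I V u w f) :
    SolvesOn I V (k • u) (k • w) (k • f) where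
  hasDerivAt x hx := (h.hasDerivAt x hx).const_smul k
  absolutelyContinuous a ha b hb := (h.absolutelyContinuous a ha b hb).const_smul k
  ae_eq := by
    filter_upwards [h.ae_eq] with x h1
    have := h1.const_smul k
    rw [show k • ((V x : ℂ) * u x - f x) = (V x : ℂ) * (k • u) x - (k • f) x by
      simp only [Pi.smul_apply, smul_eq_mul]; ring] at this
    exact this

lemma SolvesOn.congr {I : Set ℝ} {V : ℝ → ℝ} {u w f f' : ℝ → ℂ} (h : SolvesOn I V u w f)
    (hf : f' =ᵐ[volume.restrict I] f) : SolvesOn I V u w f' where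
  hasDerivAt := h.hasDerivAt
  absolutelyContinuous := h.absolutelyContinuous
  ae_eq := by
    filter_upwards [h.ae_eq, hf] with x h1 h2
    rwa [h2]

/-- The graph of `H_α(V)`: all pairs `(ψ, f)` of states such that `ψ` has, on every link, a
representative `u j` which is differentiable with a locally absolutely continuous derivative and
satisfies `-(u j)'' + V j (u j) = f j`, and such that the boundary conditions hold. -/
def hamiltonianGraph {N : ℕ} (ℓ : Fin N → EReal) (V : Fin N → ℝ → ℝ) (ω : Fin N → ℝ)
    (α : OnePoint ℝ) : Submodule ℂ (StateSpace ℓ × StateSpace ℓ) where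
  carrier := {p | ∃ u w : Fin N → ℝ → ℂ,
    (∀ j, (p.1 j : ℝ → ℂ) =ᵐ[volume.restrict (link (ℓ j))] u j) ∧
    (∀ j, SolvesOn (link (ℓ j)) (V j) (u j) (w j) (p.2 j)) ∧
    VertexCondition α u w ∧ EndCondition ℓ ω u w}
  zero_mem' := by
    refine ⟨0, 0, fun j => Lp.coeFn_zero _ _ _,
      fun j => (SolvesOn.zero _ _).congr (Lp.coeFn_zero _ _ _), ⟨fun a _ => ?_, fun _ j => ?_⟩,
      fun j L _ => ?_⟩
    · exact ⟨0, 0, fun j => tendsto_const_nhds, fun j => tendsto_const_nhds, by simp⟩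
    · exact tendsto_const_nhds
    · exact ⟨0, 0, tendsto_const_nhds, tendsto_const_nhds, by simp⟩
  add_mem' := by
    rintro p q ⟨u, w, h1, h2, h3, h4⟩ ⟨u', w', h1', h2', h3', h4'⟩
    refine ⟨u + u', w + w', fun j => (Lp.coeFn_add _ _).trans ((h1 j).add (h1' j)),
      fun j => ((h2 j).add (h2' j)).congr (Lp.coeFn_add _ _), ⟨fun a ha => ?_, fun ha j => ?_⟩,
      fun j L hL => ?_⟩
    · obtain ⟨c, d, hc, hd, he⟩ := h3.1 a ha
      obtain ⟨c', d', hc', hd', he'⟩ := h3'.1 a ha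
      refine ⟨c + c', d + d', fun j => (hc j).add (hc' j), fun j => (hd j).add (hd' j), ?_⟩
      simp only [Pi.add_apply, Finset.sum_add_distrib, he, he']
      ring
    · have := (h3.2 ha j).add (h3'.2 ha j)
      rw [add_zero] at this
      exact this
    · obtain ⟨c, d, hc, hd, he⟩ := h4 j L hL
      obtain ⟨c', d', hc', hd', he'⟩ := h4' j L hL
      exact ⟨c + c', d + d', hc.add hc', hd.add hd', by linear_combination he + he'⟩
  smul_mem' := by
    rintro k p ⟨u, w, h1, h2, h3, h4⟩
    refine ⟨k • u, k • w, fun j => (Lp.coeFn_smul _ _).trans ((h1 j).const_smul k),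
      fun j => ((h2 j).smul k).congr (Lp.coeFn_smul _ _), ⟨fun a ha => ?_, fun ha j => ?_⟩,
      fun j L hL => ?_⟩
    · obtain ⟨c, d, hc, hd, he⟩ := h3.1 a ha
      refine ⟨k • c, k • d, fun j => (hc j).const_smul k, fun j => (hd j).const_smul k, ?_⟩
      simp only [Pi.smul_apply, smul_eq_mul, ← Finset.mul_sum, he]
      ring
    · have := (h3.2 ha j).const_smul k
      rw [smul_zero] at this
      exact this
    · obtain ⟨c, d, hc, hd, he⟩ := h4 j L hL
      refine ⟨k • c, k • d, hc.const_smul k, hd.const_smul k, ?_⟩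
      simp only [smul_eq_mul]
      linear_combination k * he

/-- `hamiltonianGraph` is single valued, hence really the graph of an operator. -/
lemma hamiltonianGraph_snd_eq_zero {N : ℕ} (ℓ : Fin N → EReal) (V : Fin N → ℝ → ℝ)
    (ω : Fin N → ℝ) (α : OnePoint ℝ) (p : StateSpace ℓ × StateSpace ℓ)
    (hp : p ∈ hamiltonianGraph ℓ V ω α) (h0 : p.1 = 0) : p.2 = 0 := by
  obtain ⟨u, w, h1, h2, -, -⟩ := hp
  ext1 j
  have hI := isOpen_link (ℓ j)
  have hu : EqOn (u j) 0 (link (ℓ j)) := by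
    refine Measure.eqOn_open_of_ae_eq (μ := volume) ?_ hI
      (fun x hx => ((h2 j).hasDerivAt x hx).continuousAt.continuousWithinAt) continuousOn_const
    refine (h1 j).symm.trans ?_
    rw [h0]
    exact Lp.coeFn_zero _ _ _
  have hw : EqOn (w j) 0 (link (ℓ j)) := fun x hx =>
    ((h2 j).hasDerivAt x hx).unique ((hasDerivAt_const x (0 : ℂ)).congr_of_eventuallyEq
      (by filter_upwards [hI.mem_nhds hx] with y hy using hu hy))
  refine Lp.ext (EventuallyEq.trans ?_ (Lp.coeFn_zero _ _ _).symm)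
  filter_upwards [(h2 j).ae_eq, ae_restrict_mem hI.measurableSet] with x hx hxI
  have := hx.unique ((hasDerivAt_const x (0 : ℂ)).congr_of_eventuallyEq
      (by filter_upwards [hI.mem_nhds hxI] with y hy using hw hy))
  rw [hu hxI] at this
  simpa using this

/-- The operator `H_α(V)`, with the fixed boundary conditions given by `ω` at the finite ends. -/
def hamiltonian {N : ℕ} (ℓ : Fin N → EReal) (V : Fin N → ℝ → ℝ) (ω : Fin N → ℝ)
    (α : OnePoint ℝ) : StateSpace ℓ →ₗ.[ℂ] StateSpace ℓ :=
  (hamiltonianGraph ℓ V ω α).toLinearPMap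

lemma hamiltonian_graph {N : ℕ} (ℓ : Fin N → EReal) (V : Fin N → ℝ → ℝ) (ω : Fin N → ℝ)
    (α : OnePoint ℝ) : (hamiltonian ℓ V ω α).graph = hamiltonianGraph ℓ V ω α :=
  Submodule.toLinearPMap_graph_eq _ (hamiltonianGraph_snd_eq_zero ℓ V ω α)

end StarGraph

end

/-!
For nonreal `z`, the Dirichlet problem `-u'' + Q u = z u + f`, `u 0 = 0` on a link has a square
integrable solution with `|Im z| ‖u‖ ≤ ‖f‖`: the solutions vanishing at the vertex form a complex
line, those which satisfy the bound on `(0, b)` form a nonempty compact set, and these sets decrease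
as `b → ∞` (Weyl's nested discs). Correcting a function which is `1` at the vertex and has bounded
support gives the Weyl solution `ψ` with `ψ 0 = 1`.

In the limit point case the Dirichlet solution is unique, so every function of the domain vanishing
at the vertex satisfies the resolvent bound for all `z`. Along the imaginary axis this forces
`Im ∫ F ū = 0` where `F = -u'' + Q u`: there is no boundary term at infinity. In general
`Im ∫ F ū = -Im (u 0 * conj (u' 0))`, and the vertex condition makes the sum of these terms vanish,
which is symmetry. Applied to `ψ`, the identity says that `Im ψ' 0` has the sign of `Im z`, so a
common multiple of the Weyl solutions can be added to the Dirichlet solutions to meet the vertex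
condition. Hence `H - z` is surjective for all nonreal `z`.
-/

namespace StarGraph

open scoped ComplexConjugate

/-! ### Absolutely continuous functions -/

section AbsolutelyContinuous

variable {E : Type*} [NormedAddCommGroup E]

lemma intervalIntegrable_of_locallyIntegrable {f : ℝ → E} (hf : LocallyIntegrable f) (a b : ℝ) :
    IntervalIntegrable f volume a b :=
  intervalIntegrable_iff.2 <|
    (hf.integrableOn_isCompact isCompact_uIcc).mono_set uIoc_subset_uIcc

lemma absolutelyContinuousOnInterval_conj {f : ℝ → ℂ} {a b : ℝ}
    (hf : AbsolutelyContinuousOnInterval f a b) :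
    AbsolutelyContinuousOnInterval (fun x => conj (f x)) a b := by
  simpa only [AbsolutelyContinuousOnInterval, Complex.dist_conj_conj] using hf

lemma absolutelyContinuousOnInterval_lipschitzOnWith_comp {X Y : Type*} [PseudoMetricSpace X]
    [PseudoMetricSpace Y] {f : ℝ → X} {g : X → Y} {a b : ℝ} {K : NNReal}
    (hg : LipschitzOnWith K g (f '' uIcc a b)) (hf : AbsolutelyContinuousOnInterval f a b) :
    AbsolutelyContinuousOnInterval (g ∘ f) a b := by
  rw [absolutelyContinuousOnInterval_iff] at hf ⊢
  intro ε hε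
  obtain ⟨δ, hδ, hf⟩ := hf (ε / (K + 1)) (by positivity)
  refine ⟨δ, hδ, fun I hI hIδ => ?_⟩
  calc
    _ ≤ ∑ i ∈ Finset.range I.1, (K + 1 : ℝ) * dist (f (I.2 i).1) (f (I.2 i).2) := by
      refine Finset.sum_le_sum fun i hi => ?_
      obtain ⟨hx, hy⟩ := hI.1 i hi
      refine (hg.dist_le_mul _ (mem_image_of_mem f hx) _ (mem_image_of_mem f hy)).trans ?_
      gcongr
      simp
    _ < ε := by
      rw [← Finset.mul_sum, mul_comm]
      exact (lt_div_iff₀ (by positivity)).1 (hf I hI hIδ)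

variable [NormedSpace ℝ E]

lemma absolutelyContinuousOnInterval_contDiff_comp {f : ℝ → ℝ} {g : ℝ → E} {a b : ℝ}
    (hg : ContDiff ℝ 1 g) (hf : AbsolutelyContinuousOnInterval f a b) :
    AbsolutelyContinuousOnInterval (g ∘ f) a b := by
  obtain ⟨K, hK⟩ := hg.locallyLipschitz.locallyLipschitzOn.exists_lipschitzOnWith_of_compact
    (isCompact_uIcc.image_of_continuousOn hf.continuousOn)
  exact absolutelyContinuousOnInterval_lipschitzOnWith_comp hK hf

lemma absolutelyContinuousOnInterval_primitive {f : ℝ → E} {a b c : ℝ}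
    (h : IntervalIntegrable f volume a b) (hc : c ∈ uIcc a b) :
    AbsolutelyContinuousOnInterval (fun x => ∫ t in c..x, f t) a b := by
  have hnorm := h.norm.absolutelyContinuousOnInterval_intervalIntegral hc
  rw [absolutelyContinuousOnInterval_iff] at hnorm ⊢
  intro ε hε
  obtain ⟨δ, hδ, hsum⟩ := hnorm ε hε
  refine ⟨δ, hδ, fun I hI hIδ => (Finset.sum_le_sum fun i hi => ?_).trans_lt (hsum I hI hIδ)⟩
  obtain ⟨hx, hy⟩ := hI.1 i hi
  have hcx : uIcc c (I.2 i).1 ⊆ uIcc a b := uIcc_subset_uIcc hc hx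
  have hcy : uIcc c (I.2 i).2 ⊆ uIcc a b := uIcc_subset_uIcc hc hy
  rw [dist_eq_norm, dist_eq_norm,
    intervalIntegral.integral_interval_sub_left (h.mono_set hcx) (h.mono_set hcy),
    intervalIntegral.integral_interval_sub_left (h.norm.mono_set hcx) (h.norm.mono_set hcy)]
  exact intervalIntegral.norm_integral_le_abs_integral_norm

lemma integral_eq_sub_of_absolutelyContinuousOnInterval [CompleteSpace E] {f f' : ℝ → E} {a b : ℝ}
    (hf : AbsolutelyContinuousOnInterval f a b) (hf' : IntervalIntegrable f' volume a b)
    (hderiv : ∀ᵐ x, x ∈ uIcc a b → HasDerivAt f (f' x) x) :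
    ∫ t in a..b, f' t = f b - f a := by
  have hac := hf.sub (absolutelyContinuousOnInterval_primitive hf' left_mem_uIcc)
  have hzero : ∀ᵐ x, x ∈ uIcc a b → HasDerivAt (f - fun x => ∫ t in a..x, f' t) 0 x := by
    filter_upwards [hderiv, hf'.ae_hasDerivAt_integral] with x hfx hx hmem
    simpa only [sub_self] using (hfx hmem).sub (hx hmem a left_mem_uIcc)
  obtain ⟨C, hC⟩ := hac.const_of_ae_hasDerivAt_zero hzero
  have ha := hC a left_mem_uIcc
  have hb := hC b right_mem_uIcc
  simp only [Pi.sub_apply, intervalIntegral.integral_same, sub_zero] at ha hb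
  rw [ha, ← hb]
  abel

end AbsolutelyContinuous

/-! ### Carathéodory differential equations -/

section Caratheodory

variable {E : Type*} [NormedAddCommGroup E]

/-- The weight `cosh (2 ∫ₐˣ ρ)` used in the norm `sup ‖Y‖ / weight`, in which the Picard iteration
of an equation with Lipschitz constant `ρ` contracts on the whole line. Using `cosh` rather than
`exp` treats both sides of `a` alike. -/
noncomputable def picardWeight (ρ : ℝ → ℝ) (a x : ℝ) : ℝ := Real.cosh (2 * ∫ t in a..x, ρ t)

lemma picardWeight_pos (ρ : ℝ → ℝ) (a x : ℝ) : 0 < picardWeight ρ a x := Real.cosh_pos _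

lemma one_le_picardWeight (ρ : ℝ → ℝ) (a x : ℝ) : 1 ≤ picardWeight ρ a x := Real.one_le_cosh _

lemma continuous_picardWeight {ρ : ℝ → ℝ} (hρ : LocallyIntegrable ρ) (a : ℝ) :
    Continuous (picardWeight ρ a) := by
  have := intervalIntegral.continuous_primitive (intervalIntegrable_of_locallyIntegrable hρ) a
  unfold picardWeight
  fun_prop

lemma integral_mul_picardWeight {ρ : ℝ → ℝ} (hρ : LocallyIntegrable ρ) (a x : ℝ) :
    ∫ t in a..x, ρ t * picardWeight ρ a t = Real.sinh (2 * ∫ t in a..x, ρ t) / 2 := by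
  have hint := intervalIntegrable_of_locallyIntegrable hρ a x
  have hac : AbsolutelyContinuousOnInterval
      (fun x => (Real.sinh ∘ fun x => 2 * ∫ t in a..x, ρ t) x / 2) a x := by
    simp only [div_eq_inv_mul]
    exact (absolutelyContinuousOnInterval_contDiff_comp Real.contDiff_sinh
      ((absolutelyContinuousOnInterval_primitive hint left_mem_uIcc).const_mul 2)).const_mul _
  rw [integral_eq_sub_of_absolutelyContinuousOnInterval hac
    (hint.mul_continuousOn (continuous_picardWeight hρ a).continuousOn)]
  · simp
  · filter_upwards [LocallyIntegrable.ae_hasDerivAt_integral hρ] with t ht _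
    exact ((((ht a).const_mul 2).sinh).div_const 2).congr_deriv (by rw [picardWeight]; ring)

/-- A vector field `G` on `E` to which the Carathéodory theory applies: Lipschitz in space with
constant `ρ t` at time `t`, of size at most `ρ t` at the origin, for a locally integrable `ρ`. -/
structure IsCaratheodory (G : ℝ → E → E) (ρ : ℝ → ℝ) : Prop where
  locallyIntegrable_bound : LocallyIntegrable ρ
  norm_sub_le : ∀ t x y, ‖G t x - G t y‖ ≤ ρ t * ‖x - y‖
  norm_zero_le : ∀ t, ‖G t 0‖ ≤ ρ t
  locallyIntegrable_comp : ∀ Y : ℝ → E, Continuous Y → LocallyIntegrable fun t => G t (Y t)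

lemma IsCaratheodory.bound_nonneg {G : ℝ → E → E} {ρ : ℝ → ℝ} (h : IsCaratheodory G ρ) (t : ℝ) :
    0 ≤ ρ t :=
  (norm_nonneg _).trans (h.norm_zero_le t)

variable [NormedSpace ℝ E]

lemma norm_integral_le_picardWeight {ρ : ℝ → ℝ} (hρ : LocallyIntegrable ρ) {a x M : ℝ} (hM : 0 ≤ M)
    {g : ℝ → E} (hg : ∀ t ∈ uIcc a x, ‖g t‖ ≤ M * (ρ t * picardWeight ρ a t)) :
    ‖∫ t in a..x, g t‖ ≤ M / 2 * picardWeight ρ a x := by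
  have hint := (intervalIntegrable_of_locallyIntegrable hρ a x).mul_continuousOn
    (continuous_picardWeight hρ a).continuousOn
  calc
    _ ≤ |∫ t in a..x, M * (ρ t * picardWeight ρ a t)| := by
      refine intervalIntegral.norm_integral_le_abs_of_norm_le ?_ (hint.const_mul M)
      filter_upwards [ae_restrict_mem measurableSet_uIoc] with t ht
      exact hg t (uIoc_subset_uIcc ht)
    _ = M / 2 * |Real.sinh (2 * ∫ t in a..x, ρ t)| := by
      rw [intervalIntegral.integral_const_mul, integral_mul_picardWeight hρ, abs_mul, abs_div,
        abs_of_nonneg hM, abs_two]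
      ring
    _ ≤ M / 2 * picardWeight ρ a x := by
      gcongr
      rw [Real.abs_sinh, picardWeight, ← Real.cosh_abs]
      exact (Real.sinh_lt_cosh _).le

theorem eq_zero_of_norm_le_mul_norm_of_eq_integral {ρ : ℝ → ℝ} (hρ : LocallyIntegrable ρ)
    (hρ0 : ∀ t, 0 ≤ ρ t) {a b : ℝ} {Y g : ℝ → E} (hY : ContinuousOn Y (uIcc a b))
    (hint : ∀ x ∈ uIcc a b, Y x = ∫ t in a..x, g t)
    (hg : ∀ t ∈ uIcc a b, ‖g t‖ ≤ ρ t * ‖Y t‖) : ∀ x ∈ uIcc a b, Y x = 0 := by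
  have hpos := picardWeight_pos ρ a
  have hcont := (continuous_picardWeight hρ a).continuousOn (s := uIcc a b)
  obtain ⟨m, hm, hmax⟩ := isCompact_uIcc.exists_isMaxOn nonempty_uIcc
    (hY.norm.div hcont fun x _ => (hpos x).ne')
  set M := ‖Y m‖ / picardWeight ρ a m
  have hM0 : 0 ≤ M := div_nonneg (norm_nonneg _) (hpos m).le
  have hle : ∀ t ∈ uIcc a b, ‖Y t‖ ≤ M * picardWeight ρ a t := fun t ht =>
    (div_le_iff₀ (hpos t)).1 (hmax ht)
  have hhalf : ‖Y m‖ ≤ M / 2 * picardWeight ρ a m := by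
    rw [hint m hm]
    refine norm_integral_le_picardWeight hρ hM0 fun t ht => ?_
    have ht' := uIcc_subset_uIcc left_mem_uIcc hm ht
    calc
      _ ≤ ρ t * (M * picardWeight ρ a t) :=
        (hg t ht').trans (mul_le_mul_of_nonneg_left (hle t ht') (hρ0 t))
      _ = _ := by ring
  have hM_le : M ≤ M / 2 := (div_le_iff₀ (hpos m)).2 hhalf
  intro x hx
  have hx0 := hle x hx
  rw [show M = 0 by linarith, zero_mul] at hx0
  exact norm_le_zero_iff.1 hx0

namespace IsCaratheodory

variable {G : ℝ → E → E} {ρ : ℝ → ℝ}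

/-- The Picard operator with initial value `y` at `a`, in the variable `v = Y / picardWeight`. -/
noncomputable def picard (G : ℝ → E → E) (ρ : ℝ → ℝ) (a : ℝ) (y : E) (v : ℝ → E) (x : ℝ) : E :=
  (picardWeight ρ a x)⁻¹ • (y + ∫ t in a..x, G t (picardWeight ρ a t • v t))

lemma locallyIntegrable_weighted (h : IsCaratheodory G ρ) (a : ℝ) {v : ℝ → E} (hv : Continuous v) :
    LocallyIntegrable fun t => G t (picardWeight ρ a t • v t) :=
  h.locallyIntegrable_comp _ ((continuous_picardWeight h.locallyIntegrable_bound a).smul hv)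

lemma continuous_picard (h : IsCaratheodory G ρ) (a : ℝ) (y : E) {v : ℝ → E} (hv : Continuous v) :
    Continuous (picard G ρ a y v) :=
  ((continuous_picardWeight h.locallyIntegrable_bound a).inv₀
    fun x => (picardWeight_pos ρ a x).ne').smul <| continuous_const.add <|
      intervalIntegral.continuous_primitive
        (intervalIntegrable_of_locallyIntegrable (h.locallyIntegrable_weighted a hv)) a

lemma norm_picard_sub_le (h : IsCaratheodory G ρ) (a : ℝ) (y : E) {v w : ℝ → E} {M : ℝ}
    (hv : Continuous v) (hw : Continuous w) (hvw : ∀ t, ‖v t - w t‖ ≤ M) (x : ℝ) :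
    ‖picard G ρ a y v x - picard G ρ a y w x‖ ≤ M / 2 := by
  have hpos := picardWeight_pos ρ a
  have hint := fun {v : ℝ → E} (hv : Continuous v) =>
    intervalIntegrable_of_locallyIntegrable (h.locallyIntegrable_weighted a hv) a x
  rw [picard, picard, ← smul_sub, add_sub_add_left_eq_sub,
    ← intervalIntegral.integral_sub (hint hv) (hint hw), norm_smul, norm_inv, Real.norm_eq_abs,
    abs_of_pos (hpos x), inv_mul_le_iff₀ (hpos x), mul_comm]
  refine norm_integral_le_picardWeight h.locallyIntegrable_bound
    ((norm_nonneg _).trans (hvw a)) fun t _ => (h.norm_sub_le _ _ _).trans ?_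
  rw [← smul_sub, norm_smul, Real.norm_eq_abs, abs_of_pos (hpos t)]
  calc
    _ ≤ ρ t * (picardWeight ρ a t * M) :=
      mul_le_mul_of_nonneg_left (mul_le_mul_of_nonneg_left (hvw t) (hpos t).le) (h.bound_nonneg t)
    _ = _ := by ring

lemma norm_picard_zero_le (h : IsCaratheodory G ρ) (a : ℝ) (y : E) (x : ℝ) :
    ‖picard G ρ a y 0 x‖ ≤ ‖y‖ + 1 / 2 := by
  have hpos := picardWeight_pos ρ a x
  have hweight := one_le_picardWeight ρ a
  have hint : ‖∫ t in a..x, G t (picardWeight ρ a t • (0 : ℝ → E) t)‖ ≤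
      1 / 2 * picardWeight ρ a x := by
    refine norm_integral_le_picardWeight h.locallyIntegrable_bound zero_le_one fun t _ => ?_
    rw [Pi.zero_apply, smul_zero, one_mul]
    exact (h.norm_zero_le t).trans (le_mul_of_one_le_right (h.bound_nonneg t) (hweight t))
  rw [picard, norm_smul, norm_inv, Real.norm_eq_abs, abs_of_pos hpos, inv_mul_le_iff₀ hpos]
  calc
    _ ≤ ‖y‖ + 1 / 2 * picardWeight ρ a x := (norm_add_le _ _).trans (by gcongr)
    _ ≤ _ := by nlinarith [norm_nonneg y, hweight x]

theorem exists_continuous_eq_add_integral [CompleteSpace E] (h : IsCaratheodory G ρ) (a : ℝ)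
    (y : E) : ∃ Y : ℝ → E, Continuous Y ∧ ∀ x, Y x = y + ∫ t in a..x, G t (Y t) := by
  have hbound : ∀ (v : BoundedContinuousFunction ℝ E) (x : ℝ),
      ‖picard G ρ a y v x‖ ≤ ‖v‖ / 2 + (‖y‖ + 1 / 2) := fun v x => by
    have hv := h.norm_picard_sub_le a y v.continuous continuous_zero
      (fun t => by simpa using v.norm_coe_le_norm t) x
    exact (norm_le_norm_sub_add _ _).trans (add_le_add hv (h.norm_picard_zero_le a y x))
  let T : BoundedContinuousFunction ℝ E → BoundedContinuousFunction ℝ E := fun v =>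
    .ofNormedAddCommGroup _ (h.continuous_picard a y v.continuous) _ (hbound v)
  have hT : ContractingWith (1 / 2) T := by
    refine ⟨by norm_num, LipschitzWith.of_dist_le_mul fun v w => ?_⟩
    refine (BoundedContinuousFunction.dist_le (by positivity)).2 fun x => ?_
    have hvw := h.norm_picard_sub_le a y v.continuous w.continuous
      (fun t => by rw [← dist_eq_norm]; exact v.dist_coe_le_dist t) x
    rw [dist_eq_norm]
    exact hvw.trans_eq (by push_cast; ring)
  set v := hT.fixedPoint T
  refine ⟨fun t => picardWeight ρ a t • v t,
    (continuous_picardWeight h.locallyIntegrable_bound a).smul v.continuous, fun x => ?_⟩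
  have hfix : v x = picard G ρ a y v x := (DFunLike.congr_fun hT.fixedPoint_isFixedPt x).symm
  change picardWeight ρ a x • v x = _
  rw [hfix, picard, smul_inv_smul₀ (picardWeight_pos ρ a x).ne']

end IsCaratheodory

end Caratheodory

/-! ### Sturm–Liouville equations -/

section SturmLiouville

lemma locallyIntegrable_norm {E : Type*} [NormedAddCommGroup E] {f : ℝ → E}
    (hf : LocallyIntegrable f) : LocallyIntegrable fun t => ‖f t‖ :=
  locallyIntegrable_iff.2 fun _ hK => (hf.integrableOn_isCompact hK).norm

lemma locallyIntegrable_clm_comp {E F : Type*} [NormedAddCommGroup E] [NormedSpace ℝ E]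
    [NormedAddCommGroup F] [NormedSpace ℝ F] (L : E →L[ℝ] F) {f : ℝ → E}
    (hf : LocallyIntegrable f) :
    LocallyIntegrable fun t => L (f t) :=
  locallyIntegrable_iff.2 fun _ hK => L.integrable_comp (hf.integrableOn_isCompact hK)

lemma locallyIntegrable_ofReal {Q : ℝ → ℝ} (hQ : LocallyIntegrable Q) :
    LocallyIntegrable fun t => (Q t : ℂ) :=
  locallyIntegrable_clm_comp Complex.ofRealCLM hQ

lemma locallyIntegrable_conj {f : ℝ → ℂ} (hf : LocallyIntegrable f) :
    LocallyIntegrable fun t => conj (f t) :=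
  locallyIntegrable_clm_comp (Complex.conjCLE : ℂ →L[ℝ] ℂ) hf

/-- The first order system `(u, w)' = (w, q u - f)` equivalent to `-u'' + q u = f`. -/
def sturmLiouvilleField (q f : ℝ → ℂ) (t : ℝ) (p : ℂ × ℂ) : ℂ × ℂ := (p.2, q t * p.1 - f t)

variable {q f : ℝ → ℂ}

lemma norm_prodMk_mul_le (c : ℂ) (p : ℂ × ℂ) : ‖(p.2, c * p.1)‖ ≤ (1 + ‖c‖) * ‖p‖ := by
  have h1 := mul_le_mul_of_nonneg_left (norm_fst_le p) (norm_nonneg c)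
  have h2 := mul_nonneg (norm_nonneg c) (norm_nonneg p)
  refine max_le ?_ ?_
  · exact (norm_snd_le p).trans (by linarith)
  · exact (norm_mul_le _ _).trans (by linarith [norm_nonneg p])

lemma isCaratheodory_sturmLiouvilleField (hq : LocallyIntegrable q) (hf : LocallyIntegrable f) :
    IsCaratheodory (sturmLiouvilleField q f) fun t => 1 + ‖q t‖ + ‖f t‖ where
  locallyIntegrable_bound :=
    ((locallyIntegrable_const 1).add (locallyIntegrable_norm hq)).add (locallyIntegrable_norm hf)
  norm_sub_le t x y := by
    have hsub : sturmLiouvilleField q f t x - sturmLiouvilleField q f t y =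
        ((x - y).2, q t * (x - y).1) := by
      refine Prod.ext rfl ?_
      simp only [sturmLiouvilleField, Prod.snd_sub, Prod.fst_sub]
      ring
    rw [hsub]
    refine (norm_prodMk_mul_le _ _).trans ?_
    exact mul_le_mul_of_nonneg_right (by linarith [norm_nonneg (f t)]) (norm_nonneg _)
  norm_zero_le t := by
    simp only [sturmLiouvilleField, Prod.fst_zero, Prod.snd_zero, mul_zero, zero_sub, Prod.norm_mk,
      norm_zero, norm_neg, sup_of_le_right, norm_nonneg]
    linarith [norm_nonneg (q t)]
  locallyIntegrable_comp Y hY := locallyIntegrable_iff.2 fun K hK =>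
    ((continuous_snd.comp hY).locallyIntegrable.integrableOn_isCompact hK).prodMk
      (((hq.mul_continuous (continuous_fst.comp hY)).sub hf).integrableOn_isCompact hK)

lemma intervalIntegral_prodMk {E F : Type*} [NormedAddCommGroup E] [NormedSpace ℝ E]
    [CompleteSpace E] [NormedAddCommGroup F] [NormedSpace ℝ F] [CompleteSpace F] {f : ℝ → E}
    {g : ℝ → F} {a b : ℝ} (hf : IntervalIntegrable f volume a b)
    (hg : IntervalIntegrable g volume a b) :
    ∫ t in a..b, (f t, g t) = (∫ t in a..b, f t, ∫ t in a..b, g t) := by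
  simp only [intervalIntegral, integral_pair hf.1 hg.1, integral_pair hf.2 hg.2, Prod.mk_sub_mk]

theorem exists_solvesOn_univ {Q : ℝ → ℝ} (hQ : LocallyIntegrable Q) (hf : LocallyIntegrable f)
    (z : ℂ) (a : ℝ) (c d : ℂ) :
    ∃ u w, SolvesOn univ Q u w (z • u + f) ∧ u a = c ∧ w a = d := by
  have hq : LocallyIntegrable fun t => (Q t : ℂ) - z :=
    (locallyIntegrable_ofReal hQ).sub (locallyIntegrable_const z)
  obtain ⟨Y, hYcont, hY⟩ :=
    (isCaratheodory_sturmLiouvilleField hq hf).exists_continuous_eq_add_integral a (c, d)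
  have hw : Continuous fun t => (Y t).2 := continuous_snd.comp hYcont
  have hg : LocallyIntegrable fun t => ((Q t : ℂ) - z) * (Y t).1 - f t :=
    (hq.mul_continuous (continuous_fst.comp hYcont)).sub hf
  have hgint := intervalIntegrable_of_locallyIntegrable hg
  have hY' : ∀ x, Y x =
      (c + ∫ t in a..x, (Y t).2, d + ∫ t in a..x, ((Q t - z) * (Y t).1 - f t)) := fun x => by
    rw [hY x, ← Prod.mk_add_mk, ← intervalIntegral_prodMk (hw.intervalIntegrable a x) (hgint a x)]
    rfl
  have hu_eq : ∀ x, (Y x).1 = c + ∫ t in a..x, (Y t).2 := fun x => congrArg Prod.fst (hY' x)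
  have hw_eq : ∀ x, (Y x).2 = d + ∫ t in a..x, ((Q t - z) * (Y t).1 - f t) := fun x =>
    congrArg Prod.snd (hY' x)
  refine ⟨fun t => (Y t).1, fun t => (Y t).2, ⟨fun x _ => ?_, fun s _ t _ => ?_, ?_⟩, ?_, ?_⟩
  · exact ((hw.integral_hasStrictDerivAt a x).hasDerivAt.const_add c).congr_of_eventuallyEq
      (.of_forall hu_eq)
  · have hs : ∀ x, (Y x).2 = (Y s).2 + ∫ t in s..x, ((Q t - z) * (Y t).1 - f t) := fun x => by
      rw [hw_eq x, hw_eq s, add_assoc,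
        intervalIntegral.integral_add_adjacent_intervals (hgint a s) (hgint s x)]
    rw [funext hs]
    simpa only [AbsolutelyContinuousOnInterval, dist_add_left] using
      absolutelyContinuousOnInterval_primitive (hgint s t) left_mem_uIcc
  · rw [Measure.restrict_univ]
    filter_upwards [LocallyIntegrable.ae_hasDerivAt_integral hg] with x hx
    refine ((hx a).const_add d).congr_of_eventuallyEq (.of_forall hw_eq) |>.congr_deriv ?_
    simp only [Pi.add_apply, Pi.smul_apply, smul_eq_mul]
    ring
  · simp [hY' a]
  · simp [hY' a]

lemma exists_solvesOn_univ_homogeneous {Q : ℝ → ℝ} (hQ : LocallyIntegrable Q) (z : ℂ) (a : ℝ)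
    (c d : ℂ) : ∃ u w, SolvesOn univ Q u w (z • u) ∧ u a = c ∧ w a = d := by
  simpa only [add_zero] using exists_solvesOn_univ hQ (f := 0) locallyIntegrable_zero z a c d

namespace SolvesOn

variable {I J : Set ℝ} {Q V : ℝ → ℝ} {z : ℂ} {u w v y F G : ℝ → ℂ} {a b : ℝ}

lemma restrict (h : SolvesOn J Q u w F) (hI : MeasurableSet I) (hIJ : I ⊆ J) (hQV : EqOn Q V I) :
    SolvesOn I V u w F where
  hasDerivAt x hx := h.hasDerivAt x (hIJ hx)
  absolutelyContinuous a ha b hb := h.absolutelyContinuous a (hIJ ha) b (hIJ hb)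
  ae_eq := by
    filter_upwards [ae_restrict_of_ae_restrict_of_subset hIJ h.ae_eq, ae_restrict_mem hI]
      with x hx hxI
    rwa [← hQV hxI]

lemma sub (h : SolvesOn I Q u w F) (h' : SolvesOn I Q v y G) :
    SolvesOn I Q (u - v) (w - y) (F - G) := by
  simpa only [neg_one_smul, ← sub_eq_add_neg] using h.add (h'.smul (-1))

lemma add_smul_homogeneous (h : SolvesOn I Q u w (z • u + F)) (h' : SolvesOn I Q v y (z • v))
    (c : ℂ) : SolvesOn I Q (u + c • v) (w + c • y) (z • (u + c • v) + F) := by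
  convert h.add (h'.smul c) using 1
  rw [smul_add, smul_comm z c]
  abel

lemma continuousOn (h : SolvesOn I Q u w F) : ContinuousOn u I := fun x hx =>
  (h.hasDerivAt x hx).continuousAt.continuousWithinAt

lemma continuous (h : SolvesOn univ Q u w F) : Continuous u :=
  continuousOn_univ.1 h.continuousOn

lemma continuous_deriv (h : SolvesOn univ Q u w F) : Continuous w :=
  continuous_iff_continuousAt.2 fun x =>
    (h.absolutelyContinuous (x - 1) trivial (x + 1) trivial).continuousOn.continuousAt <| by
      rw [uIcc_of_le (by linarith)]
      exact Icc_mem_nhds (by linarith) (by linarith)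

lemma absolutelyContinuous_fst (h : SolvesOn univ Q u w F) (a b : ℝ) :
    AbsolutelyContinuousOnInterval u a b := by
  refine ContDiffOn.absolutelyContinuousOnInterval (ContDiff.contDiffOn ?_)
  refine contDiff_one_iff_deriv.2 ⟨fun x => (h.hasDerivAt x trivial).differentiableAt, ?_⟩
  rw [funext fun x => (h.hasDerivAt x trivial).deriv]
  exact h.continuous_deriv

theorem eq_zero_of_homogeneous (hI : I.OrdConnected) (hQ : LocallyIntegrable Q)
    (h : SolvesOn I Q u w (z • u)) (ha : a ∈ I) (hua : u a = 0) (hwa : w a = 0) :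
    ∀ x ∈ I, u x = 0 ∧ w x = 0 := by
  intro b hb
  have hab : uIcc a b ⊆ I := hI.uIcc_subset ha hb
  have hq : LocallyIntegrable fun t => (Q t : ℂ) - z :=
    (locallyIntegrable_ofReal hQ).sub (locallyIntegrable_const z)
  have hu := h.continuousOn.mono hab
  have hw := (h.absolutelyContinuous a ha b hb).continuousOn
  have hY : ∀ x ∈ uIcc a b, (u x, w x) = ∫ t in a..x, (w t, (Q t - z) * u t) := fun x hx => by
    have hax := uIcc_subset_uIcc left_mem_uIcc hx
    have hwint : IntervalIntegrable w volume a x := (hw.mono hax).intervalIntegrable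
    have hqint := (intervalIntegrable_of_locallyIntegrable hq a x).mul_continuousOn (hu.mono hax)
    rw [intervalIntegral_prodMk hwint hqint,
      intervalIntegral.integral_eq_sub_of_hasDerivAt
        (fun t ht => h.hasDerivAt t (hab (hax ht))) hwint,
      integral_eq_sub_of_absolutelyContinuousOnInterval
        (h.absolutelyContinuous a ha x (hab hx)) hqint, hua, hwa, sub_zero, sub_zero]
    filter_upwards [(ae_restrict_iff' hI.measurableSet).1 h.ae_eq] with t ht hxt
    refine (ht (hab (hax hxt))).congr_deriv ?_
    simp only [Pi.smul_apply, smul_eq_mul]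
    ring
  have hzero := eq_zero_of_norm_le_mul_norm_of_eq_integral
    (ρ := fun t => 1 + ‖(Q t : ℂ) - z‖)
    ((locallyIntegrable_const 1).add (locallyIntegrable_norm hq))
    (fun t => by positivity) (hu.prodMk hw) hY (fun t _ => norm_prodMk_mul_le _ (u t, w t))
    b right_mem_uIcc
  exact Prod.mk_eq_zero.1 hzero

theorem exists_extension (hI : I.OrdConnected) (ha : a ∈ I) (h : SolvesOn I V u w F)
    (hV : LocallyIntegrable (I.indicator V)) (hF : LocallyIntegrable (I.indicator F)) :
    ∃ U W, SolvesOn univ (I.indicator V) U W (I.indicator F) ∧ EqOn U u I ∧ EqOn W w I := by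
  obtain ⟨U, W, hUW, hUa, hWa⟩ := exists_solvesOn_univ hV hF 0 a (u a) (w a)
  rw [zero_smul, zero_add] at hUW
  have hI' := hI.measurableSet
  have hdiff := (hUW.restrict hI' (subset_univ I) (fun _ _ => rfl)).sub
    ((h.restrict hI' subset_rfl (fun x hx => (indicator_of_mem hx V).symm)).congr
      (indicator_ae_eq_restrict hI'))
  rw [sub_self, ← zero_smul ℂ (U - u)] at hdiff
  have hzero := hdiff.eq_zero_of_homogeneous hI hV ha (sub_eq_zero.2 hUa) (sub_eq_zero.2 hWa)
  exact ⟨U, W, hUW, fun x hx => sub_eq_zero.1 (hzero x hx).1,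
    fun x hx => sub_eq_zero.1 (hzero x hx).2⟩

theorem integral_lagrange (h : SolvesOn univ Q u w F) (h' : SolvesOn univ Q v y G)
    (hF : LocallyIntegrable F) (hG : LocallyIntegrable G) (a b : ℝ) :
    ∫ t in a..b, (F t * conj (v t) - u t * conj (G t)) =
      (u b * conj (y b) - w b * conj (v b)) - (u a * conj (y a) - w a * conj (v a)) := by
  have hac := ((h.absolutelyContinuous_fst a b).smul (absolutelyContinuousOnInterval_conj
    (h'.absolutelyContinuous a trivial b trivial))).sub
    ((h.absolutelyContinuous a trivial b trivial).smul
      (absolutelyContinuousOnInterval_conj (h'.absolutelyContinuous_fst a b)))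
  have hint := (hF.mul_continuous (Complex.continuous_conj.comp h'.continuous)).sub
    ((locallyIntegrable_conj hG).continuous_mul h.continuous)
  refine integral_eq_sub_of_absolutelyContinuousOnInterval hac
    (intervalIntegrable_of_locallyIntegrable hint a b) ?_
  have hae := h.ae_eq
  have hae' := h'.ae_eq
  rw [Measure.restrict_univ] at hae hae'
  filter_upwards [hae, hae'] with x hx hx' _
  refine (((h.hasDerivAt x trivial).smul hx'.star).sub
    (hx.smul (h'.hasDerivAt x trivial).star)).congr_deriv ?_
  simp only [smul_eq_mul, RCLike.star_def, map_sub, map_mul, Complex.conj_ofReal]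
  ring

end SolvesOn

end SturmLiouville

/-! ### The regular boundary value problem on a bounded interval -/

section Regular

lemma norm_sub_mul_sq (z a b : ℂ) :
    ‖b - z * a‖ ^ 2 = ‖b - z.re * a‖ ^ 2 + z.im ^ 2 * ‖a‖ ^ 2 - 2 * z.im * (b * conj a).im := by
  simp only [← Complex.normSq_eq_norm_sq, Complex.normSq_apply, Complex.sub_re, Complex.sub_im,
    Complex.mul_re, Complex.mul_im, Complex.conj_re, Complex.conj_im, Complex.ofReal_re,
    Complex.ofReal_im]
  ring

lemma integrable_im_mul_conj {X : Type*} [MeasurableSpace X] {μ : Measure X} {u F : X → ℂ}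
    (hF : MemLp F 2 μ) (hu : MemLp u 2 μ) : Integrable (fun x => (F x * conj (u x)).im) μ :=
  (hF.integrable_mul hu.star).im

lemma sq_im_mul_integral_norm_sq_le {X : Type*} [MeasurableSpace X] {μ : Measure X}
    {u f : X → ℂ} {z : ℂ} (hu : MemLp u 2 μ) (hf : MemLp f 2 μ)
    (h : ∫ x, ((z • u + f) x * conj (u x)).im ∂μ = 0) :
    z.im ^ 2 * ∫ x, ‖u x‖ ^ 2 ∂μ ≤ ∫ x, ‖f x‖ ^ 2 ∂μ := by
  have hF : MemLp (z • u + f) 2 μ := (hu.const_smul z).add hf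
  have hnorm := (hu.integrable_norm_pow two_ne_zero).const_mul (z.im ^ 2)
  have him := (integrable_im_mul_conj hF hu).const_mul (2 * z.im)
  calc
    _ = ∫ x, (z.im ^ 2 * ‖u x‖ ^ 2 - 2 * z.im * ((z • u + f) x * conj (u x)).im) ∂μ := by
      rw [integral_sub hnorm him, integral_const_mul, integral_const_mul, h, mul_zero, sub_zero]
    _ ≤ _ := by
      refine integral_mono (hnorm.sub him) (hf.integrable_norm_pow two_ne_zero) fun x => ?_
      have hx := norm_sub_mul_sq z (u x) ((z • u + f) x)
      rw [show (z • u + f) x - z * u x = f x by simp] at hx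
      linarith [sq_nonneg ‖(z • u + f) x - z.re * u x‖]

lemma memLp_restrict_Icc_of_continuous {E : Type*} [NormedAddCommGroup E] {q : ENNReal} {u : ℝ → E}
    (hu : Continuous u) (a b : ℝ) : MemLp u q (volume.restrict (Icc a b)) := by
  obtain ⟨C, hC⟩ := (isCompact_Icc (a := a) (b := b)).exists_bound_of_continuousOn hu.continuousOn
  exact .of_bound hu.aestronglyMeasurable C ((ae_restrict_mem measurableSet_Icc).mono hC)

lemma im_mul_conj_eq_zero_of_mul_cos_add_mul_sin {c d : ℂ} {ω : ℝ}
    (h : c * Real.cos ω + d * Real.sin ω = 0) : (c * conj d).im = 0 := by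
  have hre := congrArg Complex.re h
  have him := congrArg Complex.im h
  simp only [Complex.add_re, Complex.add_im, Complex.re_mul_ofReal, Complex.im_mul_ofReal,
    Complex.zero_re, Complex.zero_im] at hre him
  simp only [Complex.mul_im, Complex.conj_re, Complex.conj_im]
  linear_combination (Real.cos ω * d.re - Real.sin ω * c.re) * him +
    (Real.sin ω * c.im - Real.cos ω * d.im) * hre -
    (c.im * d.re - c.re * d.im) * Real.sin_sq_add_cos_sq ω

namespace SolvesOn

variable {Q : ℝ → ℝ} {z : ℂ} {u w F p p' f φ φ' : ℝ → ℂ} {a b ω : ℝ}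

lemma integral_im_mul_conj (h : SolvesOn univ Q u w F) (hF : LocallyIntegrable F) (a b : ℝ) :
    ∫ t in a..b, (F t * conj (u t)).im = (u b * conj (w b)).im - (u a * conj (w a)).im := by
  have hlagrange := congrArg Complex.im (h.integral_lagrange h hF hF a b)
  have hsub : ∀ c d : ℂ, c * conj d - d * conj c = ((2 * (c * conj d).im : ℝ) : ℂ) * Complex.I :=
    fun c d => by simpa [mul_comm d] using Complex.sub_conj (c * conj d)
  simp only [hsub, intervalIntegral.integral_mul_const, intervalIntegral.integral_ofReal,
    intervalIntegral.integral_const_mul, Complex.sub_im, Complex.im_ofReal_mul, Complex.I_im,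
    mul_one] at hlagrange
  linarith

lemma integral_norm_sq_pos (h : SolvesOn univ Q u w F) (hua : u a ≠ 0 ∨ w a ≠ 0) (hab : a < b) :
    0 < ∫ t in a..b, ‖u t‖ ^ 2 := by
  refine intervalIntegral.integral_pos hab (h.continuous.norm.pow 2).continuousOn
    (fun x _ => by positivity) ?_
  by_contra! hle
  have hzero : ∀ x ∈ Icc a b, u x = 0 := fun x hx => by
    simpa using (hle x hx).antisymm (sq_nonneg _)
  have ha : a ∈ Icc a b := left_mem_Icc.2 hab.le
  have hderiv : HasDerivWithinAt u 0 (Icc a b) a :=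
    (hasDerivWithinAt_const a (Icc a b) (0 : ℂ)).congr hzero (hzero a ha)
  have hwa := (uniqueDiffOn_Icc hab a ha).eq_deriv _ (h.hasDerivAt a trivial).hasDerivWithinAt
    hderiv
  exact hua.elim (fun hu => hu (hzero a ha)) (fun hw => hw hwa)

lemma locallyIntegrable_smul_add (h : SolvesOn univ Q u w F) (hf : LocallyIntegrable f) (z : ℂ) :
    LocallyIntegrable (z • u + f) :=
  (h.continuous.const_smul z).locallyIntegrable.add hf

lemma sq_im_mul_integral_norm_sq_le (h : SolvesOn univ Q u w (z • u + f))
    (hf : LocallyIntegrable f) (hab : a ≤ b) (hfL2 : MemLp f 2 (volume.restrict (Ioc a b)))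
    (hua : u a = 0) (hub : u b * Real.cos ω + w b * Real.sin ω = 0) :
    z.im ^ 2 * ∫ t in a..b, ‖u t‖ ^ 2 ≤ ∫ t in a..b, ‖f t‖ ^ 2 := by
  have henergy := h.integral_im_mul_conj (h.locallyIntegrable_smul_add hf z) a b
  rw [im_mul_conj_eq_zero_of_mul_cos_add_mul_sin hub, hua, zero_mul, Complex.zero_im,
    sub_zero] at henergy
  rw [intervalIntegral.integral_of_le hab] at henergy ⊢
  rw [intervalIntegral.integral_of_le hab]
  refine StarGraph.sq_im_mul_integral_norm_sq_le ?_ hfL2 henergy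
  exact (memLp_restrict_Icc_of_continuous h.continuous a b).mono_measure
    (Measure.restrict_mono Ioc_subset_Icc_self le_rfl)

lemma mul_cos_add_mul_sin_ne_zero (hz : z.im ≠ 0) (h : SolvesOn univ Q φ φ' (z • φ))
    (hφ : φ a = 0) (hφ' : φ' a ≠ 0) (hab : a < b) (ω : ℝ) :
    φ b * Real.cos ω + φ' b * Real.sin ω ≠ 0 := by
  intro hb
  have hpos := h.integral_norm_sq_pos (.inr hφ') hab
  rw [← add_zero (z • φ)] at h
  have hle := h.sq_im_mul_integral_norm_sq_le locallyIntegrable_zero hab.le MemLp.zero hφ hb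
  simp only [Pi.zero_apply, norm_zero, ne_eq, OfNat.ofNat_ne_zero, not_false_eq_true, zero_pow,
    intervalIntegral.integral_zero] at hle
  exact hle.not_gt (by positivity)

lemma exists_add_smul_norm_le (hz : z.im ≠ 0) (hp : SolvesOn univ Q p p' (z • p + f))
    (hφ : SolvesOn univ Q φ φ' (z • φ)) (hpa : p a = 0) (hφa : φ a = 0) (hφa' : φ' a ≠ 0)
    (hf : LocallyIntegrable f) (hab : a < b) (hfL2 : MemLp f 2 (volume.restrict (Ioc a b)))
    (ω : ℝ) :
    ∃ c : ℂ, (p + c • φ) b * Real.cos ω + (p' + c • φ') b * Real.sin ω = 0 ∧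
      z.im ^ 2 * ∫ t in a..b, ‖(p + c • φ) t‖ ^ 2 ≤ ∫ t in a..b, ‖f t‖ ^ 2 := by
  set B := φ b * Real.cos ω + φ' b * Real.sin ω with hB
  have hB0 : B ≠ 0 := mul_cos_add_mul_sin_ne_zero hz hφ hφa hφa' hab ω
  set c := -(p b * Real.cos ω + p' b * Real.sin ω) / B
  have hend : (p + c • φ) b * Real.cos ω + (p' + c • φ') b * Real.sin ω = 0 := by
    have hcB : c * B = -(p b * Real.cos ω + p' b * Real.sin ω) := div_mul_cancel₀ _ hB0
    simp only [Pi.add_apply, Pi.smul_apply, smul_eq_mul]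
    linear_combination hcB + c * hB
  exact ⟨c, hend, (hp.add_smul_homogeneous hφ c).sq_im_mul_integral_norm_sq_le hf hab.le hfL2
    (by simp [hpa, hφa]) hend⟩

end SolvesOn

end Regular

/-! ### Weyl's nested discs -/

section NestedDiscs

lemma continuous_integral_norm_add_smul_sq {p φ : ℝ → ℂ} (hp : Continuous p) (hφ : Continuous φ)
    (a b : ℝ) : Continuous fun c : ℂ => ∫ t in a..b, ‖(p + c • φ) t‖ ^ 2 :=
  intervalIntegral.continuous_parametric_intervalIntegral_of_continuous'
    (by simp only [Pi.add_apply, Pi.smul_apply]; fun_prop) a b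

lemma norm_sq_mul_integral_norm_sq_le {p φ : ℝ → ℂ} (hp : Continuous p) (hφ : Continuous φ)
    {a b : ℝ} (hab : a ≤ b) (c : ℂ) :
    ‖c‖ ^ 2 * ∫ t in a..b, ‖φ t‖ ^ 2 ≤
      2 * (∫ t in a..b, ‖(p + c • φ) t‖ ^ 2) + 2 * ∫ t in a..b, ‖p t‖ ^ 2 := by
  rw [← intervalIntegral.integral_const_mul, ← intervalIntegral.integral_const_mul,
    ← intervalIntegral.integral_const_mul, ← intervalIntegral.integral_add
      (Continuous.intervalIntegrable (by fun_prop) _ _)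
      (Continuous.intervalIntegrable (by fun_prop) _ _)]
  refine intervalIntegral.integral_mono hab (Continuous.intervalIntegrable (by fun_prop) _ _)
    (Continuous.intervalIntegrable (by fun_prop) _ _) fun t => ?_
  have hle : ‖c‖ * ‖φ t‖ ≤ ‖(p + c • φ) t‖ + ‖p t‖ := by
    rw [← norm_mul]
    simpa using norm_sub_le ((p + c • φ) t) (p t)
  calc
    _ = (‖c‖ * ‖φ t‖) ^ 2 := (mul_pow _ _ 2).symm
    _ ≤ (‖(p + c • φ) t‖ + ‖p t‖) ^ 2 := by gcongr
    _ ≤ _ := by linarith [two_mul_le_add_sq ‖(p + c • φ) t‖ ‖p t‖]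

lemma memLp_restrict_Ioi_of_forall_integral_norm_sq_le {u : ℝ → ℂ} (hu : Continuous u) {a C : ℝ}
    (h : ∀ n : ℕ, ∫ t in a..(a + 1 + n), ‖u t‖ ^ 2 ≤ C) :
    MemLp u 2 (volume.restrict (Ioi a)) ∧ ∫ t in Ioi a, ‖u t‖ ^ 2 ≤ C := by
  have hsq : Continuous fun t => ‖u t‖ ^ 2 := by fun_prop
  have htop : Tendsto (fun n : ℕ => a + 1 + (n : ℝ)) atTop atTop :=
    tendsto_atTop_add_const_left _ _ tendsto_natCast_atTop_atTop
  have hint : IntegrableOn (fun t => ‖u t‖ ^ 2) (Ioi a) :=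
    integrableOn_Ioi_of_intervalIntegral_norm_bounded C a
      (fun n => (hsq.continuousOn.integrableOn_Icc).mono_set Ioc_subset_Icc_self) htop
      (.of_forall fun n => by simpa only [Real.norm_eq_abs, abs_pow, abs_norm] using h n)
  exact ⟨(memLp_two_iff_integrable_sq_norm hu.aestronglyMeasurable).2 hint,
    le_of_tendsto' (intervalIntegral_tendsto_integral_Ioi a hint htop) h⟩

theorem exists_add_smul_memLp_restrict_Ioi {p φ : ℝ → ℂ} (hp : Continuous p) (hφ : Continuous φ)
    {a C : ℝ} (hφa : 0 < ∫ t in a..(a + 1), ‖φ t‖ ^ 2)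
    (h : ∀ b > a, ∃ c : ℂ, ∫ t in a..b, ‖(p + c • φ) t‖ ^ 2 ≤ C) :
    ∃ c : ℂ, MemLp (p + c • φ) 2 (volume.restrict (Ioi a)) ∧
      ∫ t in Ioi a, ‖(p + c • φ) t‖ ^ 2 ≤ C := by
  let disc : ℕ → Set ℂ := fun n => {c | ∫ t in a..(a + 1 + n), ‖(p + c • φ) t‖ ^ 2 ≤ C}
  have hsum : ∀ c : ℂ, Continuous (p + c • φ) := fun c => hp.add (hφ.const_smul c)
  have hclosed : ∀ n, IsClosed (disc n) := fun n =>
    isClosed_le (continuous_integral_norm_add_smul_sq hp hφ _ _) continuous_const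
  have hmono : ∀ n, disc (n + 1) ⊆ disc n := fun n c hc => by
    refine (intervalIntegral.integral_mono_interval le_rfl ?_ ?_
      (.of_forall fun t => sq_nonneg _) (((hsum c).norm.pow 2).intervalIntegrable _ _)).trans hc
    · linarith [n.cast_nonneg (α := ℝ)]
    · push_cast
      linarith
  have hbounded : Bornology.IsBounded (disc 0) := by
    set S := ∫ t in a..(a + 1), ‖φ t‖ ^ 2
    refine (Metric.isBounded_closedBall (x := 0)
      (r := √((2 * C + 2 * ∫ t in a..(a + 1), ‖p t‖ ^ 2) / S))).subset fun c hc => ?_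
    rw [mem_closedBall_zero_iff]
    refine Real.le_sqrt_of_sq_le ((le_div_iff₀ hφa).2 ?_)
    have hc' : ∫ t in a..(a + 1), ‖(p + c • φ) t‖ ^ 2 ≤ C := by simpa [disc] using hc
    linarith [norm_sq_mul_integral_norm_sq_le hp hφ (b := a + 1) (by linarith) c]
  obtain ⟨c, hc⟩ := IsCompact.nonempty_iInter_of_sequence_nonempty_isCompact_isClosed disc hmono
    (fun n => h _ (by linarith [n.cast_nonneg (α := ℝ)]))
    (Metric.isCompact_of_isClosed_isBounded (hclosed 0) hbounded) hclosed
  exact ⟨c, memLp_restrict_Ioi_of_forall_integral_norm_sq_le (hsum c) fun n => mem_iInter.1 hc n⟩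

end NestedDiscs

/-! ### The domain on a single link -/

lemma link_coe (L : ℝ) : link L = Ioo 0 L := by
  ext x
  simp [link]

lemma link_top : link ⊤ = Ioi 0 := by
  ext x
  simp [link]

lemma measurableSet_link (ℓ : EReal) : MeasurableSet (link ℓ) := (isOpen_link ℓ).measurableSet

/-- The maximal domain on a single link: `u` and `F` are square integrable on the link, `u` solves
`-u'' + Q u = F` with `u' = w` and satisfies the condition at the end of the link if `ℓ < ∞`, but
no condition at the vertex. All functions are defined on the whole line, so that boundary values
are values. -/
structure InLinkDomain (ℓ : EReal) (Q : ℝ → ℝ) (ω : ℝ) (u w F : ℝ → ℂ) : Prop where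
  solvesOn : SolvesOn univ Q u w F
  locallyIntegrable : LocallyIntegrable F
  memLp_fst : MemLp u 2 (volume.restrict (link ℓ))
  memLp_rhs : MemLp F 2 (volume.restrict (link ℓ))
  end_condition : ∀ L : ℝ, ℓ = L → u L * Real.cos ω + w L * Real.sin ω = 0

lemma SolvesOn.exists_add_smul_memLp_link {ℓ : EReal} {Q : ℝ → ℝ} {z : ℂ} {p p' φ φ' f : ℝ → ℂ}
    (hz : z.im ≠ 0) (hp : SolvesOn univ Q p p' (z • p + f)) (hφ : SolvesOn univ Q φ φ' (z • φ))
    (hp0 : p 0 = 0) (hφ0 : φ 0 = 0) (hφ0' : φ' 0 ≠ 0) (hℓ : 0 < ℓ) (hf : LocallyIntegrable f)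
    (hfL2 : MemLp f 2 (volume.restrict (link ℓ))) (ω : ℝ) :
    ∃ c : ℂ, MemLp (p + c • φ) 2 (volume.restrict (link ℓ)) ∧
      (∀ L : ℝ, ℓ = L → (p + c • φ) L * Real.cos ω + (p' + c • φ') L * Real.sin ω = 0) ∧
      z.im ^ 2 * ∫ t in link ℓ, ‖(p + c • φ) t‖ ^ 2 ≤ ∫ t in link ℓ, ‖f t‖ ^ 2 := by
  induction ℓ using EReal.rec with
  | bot => exact absurd hℓ not_lt_bot
  | coe L =>
    have hL : 0 < L := EReal.coe_pos.1 hℓ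
    rw [link_coe, Measure.restrict_congr_set Ioo_ae_eq_Ioc] at hfL2 ⊢
    obtain ⟨c, hend, hle⟩ := hp.exists_add_smul_norm_le hz hφ hp0 hφ0 hφ0' hf hL hfL2 ω
    rw [intervalIntegral.integral_of_le hL.le, intervalIntegral.integral_of_le hL.le] at hle
    refine ⟨c, ?_, fun L' hL' => EReal.coe_injective hL' ▸ hend, hle⟩
    exact (memLp_restrict_Icc_of_continuous (hp.continuous.add (hφ.continuous.const_smul c))
      0 L).mono_measure (Measure.restrict_mono Ioc_subset_Icc_self le_rfl)
  | top =>
    rw [link_top] at hfL2 ⊢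
    have hz2 : 0 < z.im ^ 2 := by positivity
    obtain ⟨c, hmem, hle⟩ := exists_add_smul_memLp_restrict_Ioi hp.continuous hφ.continuous
      (hφ.integral_norm_sq_pos (.inr hφ0') (by norm_num : (0 : ℝ) < 0 + 1))
      (C := (∫ t in Ioi 0, ‖f t‖ ^ 2) / z.im ^ 2) fun b hb => by
        obtain ⟨c, -, hc⟩ := hp.exists_add_smul_norm_le hz hφ hp0 hφ0 hφ0' hf hb
          (hfL2.mono_measure (Measure.restrict_mono Ioc_subset_Ioi_self le_rfl)) 0
        refine ⟨c, (le_div_iff₀' hz2).2 (hc.trans ?_)⟩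
        rw [intervalIntegral.integral_of_le (le_of_lt hb)]
        exact setIntegral_mono_set (hfL2.integrable_norm_pow two_ne_zero)
          (.of_forall fun t => by positivity) Ioc_subset_Ioi_self.eventuallyLE
    exact ⟨c, hmem, fun L hL => absurd hL (EReal.top_ne_coe L), (le_div_iff₀' hz2).1 hle⟩

namespace InLinkDomain

variable {ℓ : EReal} {Q : ℝ → ℝ} {ω : ℝ} {z : ℂ} {u w F v y G f : ℝ → ℂ}

lemma add (h : InLinkDomain ℓ Q ω u w F) (h' : InLinkDomain ℓ Q ω v y G) :
    InLinkDomain ℓ Q ω (u + v) (w + y) (F + G) where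
  solvesOn := h.solvesOn.add h'.solvesOn
  locallyIntegrable := h.locallyIntegrable.add h'.locallyIntegrable
  memLp_fst := h.memLp_fst.add h'.memLp_fst
  memLp_rhs := h.memLp_rhs.add h'.memLp_rhs
  end_condition L hL := by
    simp only [Pi.add_apply]
    linear_combination h.end_condition L hL + h'.end_condition L hL

lemma smul (h : InLinkDomain ℓ Q ω u w F) (c : ℂ) :
    InLinkDomain ℓ Q ω (c • u) (c • w) (c • F) where
  solvesOn := h.solvesOn.smul c
  locallyIntegrable := h.locallyIntegrable.smul c
  memLp_fst := h.memLp_fst.const_smul c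
  memLp_rhs := h.memLp_rhs.const_smul c
  end_condition L hL := by
    simp only [Pi.smul_apply, smul_eq_mul]
    linear_combination c * h.end_condition L hL

lemma sub (h : InLinkDomain ℓ Q ω u w F) (h' : InLinkDomain ℓ Q ω v y G) :
    InLinkDomain ℓ Q ω (u - v) (w - y) (F - G) := by
  simpa only [neg_one_smul, ← sub_eq_add_neg] using h.add (h'.smul (-1))

end InLinkDomain

section Link

variable {ℓ : EReal} {Q : ℝ → ℝ} {z : ℂ} {f : ℝ → ℂ} {b : ℝ}

theorem exists_inLinkDomain_resolvent (hℓ : 0 < ℓ) (hQ : LocallyIntegrable Q) (hz : z.im ≠ 0)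
    (hf : LocallyIntegrable f) (hfL2 : MemLp f 2 (volume.restrict (link ℓ))) (ω : ℝ) :
    ∃ u w, InLinkDomain ℓ Q ω u w (z • u + f) ∧ u 0 = 0 ∧
      z.im ^ 2 * ∫ t in link ℓ, ‖u t‖ ^ 2 ≤ ∫ t in link ℓ, ‖f t‖ ^ 2 := by
  obtain ⟨p, p', hp, hp0, -⟩ := exists_solvesOn_univ hQ hf z 0 0 0
  obtain ⟨φ, φ', hφ, hφ0, hφ0'⟩ := exists_solvesOn_univ_homogeneous hQ z 0 0 1
  obtain ⟨c, hmem, hend, hle⟩ := hp.exists_add_smul_memLp_link hz hφ hp0 hφ0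
    (hφ0'.trans_ne one_ne_zero) hℓ hf hfL2 ω
  have hsol := hp.add_smul_homogeneous hφ c
  exact ⟨p + c • φ, p' + c • φ', ⟨hsol, hsol.locallyIntegrable_smul_add hf z, hmem,
    (hmem.const_smul z).add hfL2, hend⟩, by simp [hp0, hφ0], hle⟩

lemma memLp_restrict_Ioi_of_continuous_of_eq_zero {E : Type*} [NormedAddCommGroup E]
    {u : ℝ → E} {q : ENNReal} {a : ℝ} (hu : Continuous u) (hub : ∀ x, b ≤ x → u x = 0) :
    MemLp u q (volume.restrict (Ioi a)) := by
  have hind := (memLp_indicator_iff_restrict measurableSet_Icc).2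
    (memLp_restrict_Icc_of_continuous (q := q) hu a b)
  refine (hind.restrict (Ioi a)).ae_eq ?_
  filter_upwards [ae_restrict_mem measurableSet_Ioi] with x hx
  by_cases hxb : x ≤ b
  · exact indicator_of_mem (mem_Icc.2 ⟨le_of_lt hx, hxb⟩) u
  · rw [indicator_of_notMem fun h => hxb h.2, hub x (not_le.1 hxb).le]

lemma exists_solvesOn_univ_eq_zero_of_rhs_eq_zero (hQ : LocallyIntegrable Q) {F : ℝ → ℂ}
    (hF : LocallyIntegrable F) (hFb : ∀ x, b ≤ x → F x = 0) :
    ∃ u w, SolvesOn univ Q u w F ∧ ∀ x, b ≤ x → u x = 0 ∧ w x = 0 := by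
  obtain ⟨u, w, hu, hub, hwb⟩ := exists_solvesOn_univ hQ hF 0 b 0 0
  rw [zero_smul, zero_add] at hu
  refine ⟨u, w, hu, SolvesOn.eq_zero_of_homogeneous (z := 0) ordConnected_Ici hQ ?_ self_mem_Ici
    hub hwb⟩
  refine (hu.restrict measurableSet_Ici (subset_univ _) fun _ _ => rfl).congr ?_
  filter_upwards [ae_restrict_mem measurableSet_Ici] with x hx
  simp [hFb x hx]

theorem exists_solvesOn_univ_eq_zero_of_le (hQ : LocallyIntegrable Q) (hb : 0 < b) :
    ∃ g g' h, SolvesOn univ Q g g' h ∧ MemLp h 2 ∧ g 0 = 1 ∧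
      ∀ x, b ≤ x → g x = 0 ∧ g' x = 0 ∧ h x = 0 := by
  obtain ⟨φ, φ', hφ, hφ0, hφ0'⟩ := exists_solvesOn_univ_homogeneous hQ 0 0 0 1
  set H := (Ico 0 b).indicator φ with hH
  have hHL2 : MemLp H 2 := (memLp_indicator_iff_restrict measurableSet_Ico).2
    ((memLp_restrict_Icc_of_continuous hφ.continuous 0 b).mono_measure
      (Measure.restrict_mono Ico_subset_Icc_self le_rfl))
  have hHint : LocallyIntegrable H := hHL2.locallyIntegrable one_le_two
  have hHb : ∀ x, b ≤ x → H x = 0 := fun x hx =>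
    indicator_of_notMem (fun hx' => hx'.2.not_ge hx) φ
  obtain ⟨G, G', hG, hGb⟩ := exists_solvesOn_univ_eq_zero_of_rhs_eq_zero hQ hHint hHb
  have hG0 : G 0 = -((∫ t in 0..b, ‖φ t‖ ^ 2 : ℝ) : ℂ) := by
    have hlagrange := hG.integral_lagrange hφ hHint
      (hφ.continuous.const_smul (0 : ℂ)).locallyIntegrable 0 b
    simp only [hGb b le_rfl, hφ0, hφ0', zero_smul, Pi.zero_apply, map_zero, map_one, mul_zero,
      zero_mul, mul_one, sub_zero, zero_sub] at hlagrange
    rw [← neg_eq_iff_eq_neg, ← hlagrange, ← intervalIntegral.integral_ofReal]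
    refine intervalIntegral.integral_congr_ae ((Measure.ae_ne volume b).mono fun t htb ht => ?_)
    rw [uIoc_of_le hb.le] at ht
    have htI : t ∈ Ico 0 b := ⟨ht.1.le, ht.2.lt_of_ne htb⟩
    rw [hH, indicator_of_mem htI, Complex.mul_conj']
    norm_cast
  have hG0' : G 0 ≠ 0 := by
    rw [hG0, neg_ne_zero, Complex.ofReal_ne_zero]
    exact (hφ.integral_norm_sq_pos (.inr (hφ0'.trans_ne one_ne_zero)) hb).ne'
  refine ⟨_, _, _, hG.smul (G 0)⁻¹, hHL2.const_smul _, inv_mul_cancel₀ hG0', fun x hx => ?_⟩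
  simp [hGb x hx, hHb x hx]

lemma exists_inLinkDomain_eq_zero_of_le (hQ : LocallyIntegrable Q) (hb : b ∈ link ℓ) (ω : ℝ) :
    ∃ g g' h, InLinkDomain ℓ Q ω g g' h ∧ g 0 = 1 ∧
      ∀ x, b ≤ x → g x = 0 ∧ g' x = 0 ∧ h x = 0 := by
  obtain ⟨g, g', h, hg, hhL2, hg0, hgb⟩ := exists_solvesOn_univ_eq_zero_of_le hQ hb.1
  refine ⟨g, g', h, ⟨hg, hhL2.locallyIntegrable one_le_two, ?_, hhL2.restrict _, ?_⟩, hg0, hgb⟩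
  · exact (memLp_restrict_Ioi_of_continuous_of_eq_zero hg.continuous
      fun x hx => (hgb x hx).1).mono_measure (Measure.restrict_mono (fun x hx => hx.1) le_rfl)
  · rintro L rfl
    obtain ⟨hgL, hgL', -⟩ := hgb L (EReal.coe_lt_coe_iff.1 hb.2).le
    simp [hgL, hgL']

theorem exists_weyl_solution (hℓ : 0 < ℓ) (hQ : LocallyIntegrable Q) (hz : z.im ≠ 0) (ω : ℝ) :
    ∃ ψ ψ', InLinkDomain ℓ Q ω ψ ψ' (z • ψ) ∧ ψ 0 = 1 := by
  obtain ⟨b, hb, hbℓ⟩ := EReal.lt_iff_exists_real_btwn.1 hℓ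
  obtain ⟨g, g', h, hg, hg0, -⟩ :=
    exists_inLinkDomain_eq_zero_of_le hQ ⟨EReal.coe_pos.1 hb, hbℓ⟩ ω
  obtain ⟨r, r', hr, hr0, -⟩ := exists_inLinkDomain_resolvent hℓ hQ hz
    (hg.locallyIntegrable.sub (hg.solvesOn.continuous.const_smul z).locallyIntegrable)
    (hg.memLp_rhs.sub (hg.memLp_fst.const_smul z)) ω
  refine ⟨g - r, g' - r', ?_, by simp [hg0, hr0]⟩
  convert hg.sub hr using 1
  rw [smul_sub]
  abel

end Link

/-! ### The limit point case -/

section LimitPoint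

variable {V Q : ℝ → ℝ} {ω : ℝ} {z : ℂ} {u w F ψ ψ' s s' : ℝ → ℂ}

lemma SolvesOn.eq_smul_add_smul (hQ : LocallyIntegrable Q) (hu : SolvesOn univ Q u w (z • u))
    (hψ : SolvesOn univ Q ψ ψ' (z • ψ)) (hs : SolvesOn univ Q s s' (z • s)) (hψ0 : ψ 0 = 1)
    (hs0 : s 0 = 0) (hs0' : s' 0 ≠ 0) :
    u = u 0 • ψ + ((w 0 - u 0 * ψ' 0) / s' 0) • s := by
  set c := (w 0 - u 0 * ψ' 0) / s' 0
  have hc : c * s' 0 = w 0 - u 0 * ψ' 0 := div_mul_cancel₀ _ hs0'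
  have hdiff := hu.sub ((hψ.smul (u 0)).add (hs.smul c))
  rw [smul_comm, smul_comm c z, ← smul_add, ← smul_sub] at hdiff
  refine funext fun x => sub_eq_zero.1 (hdiff.eq_zero_of_homogeneous ordConnected_univ hQ
    (mem_univ 0) ?_ ?_ x trivial).1
  · simp [hψ0, hs0]
  · simp [hc]

lemma isLimitCircleAtInfinity_of_memLp (hQ : LocallyIntegrable ((Ioi 0).indicator V))
    (hψ : SolvesOn univ ((Ioi 0).indicator V) ψ ψ' (z • ψ))
    (hs : SolvesOn univ ((Ioi 0).indicator V) s s' (z • s)) (hψ0 : ψ 0 = 1) (hs0 : s 0 = 0)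
    (hs0' : s' 0 ≠ 0) (hψL2 : MemLp ψ 2 (volume.restrict (Ioi 0)))
    (hsL2 : MemLp s 2 (volume.restrict (Ioi 0))) : IsLimitCircleAtInfinity V := by
  refine ⟨z, fun u w hu => ⟨1, one_pos, ?_⟩⟩
  obtain ⟨U, W, hU, hU1, hW1⟩ := exists_solvesOn_univ_homogeneous hQ z 1 (u 1) (w 1)
  have hV : EqOn V ((Ioi 0).indicator V) (Ioi 0) := fun x hx => (indicator_of_mem hx V).symm
  have hdiff := (hu.restrict measurableSet_Ioi subset_rfl hV).sub
    (hU.restrict measurableSet_Ioi (subset_univ _) fun _ _ => rfl)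
  rw [show (fun x => z * u x) - z • U = z • (u - U) from (smul_sub z u U).symm] at hdiff
  have huU : EqOn u U (Ioi 0) := fun x hx =>
    sub_eq_zero.1 (hdiff.eq_zero_of_homogeneous ordConnected_Ioi hQ (mem_Ioi.2 one_pos)
      (sub_eq_zero.2 hU1.symm) (sub_eq_zero.2 hW1.symm) x hx).1
  have hUL2 : MemLp U 2 (volume.restrict (Ioi 0)) := by
    rw [hU.eq_smul_add_smul hQ hψ hs hψ0 hs0 hs0']
    exact (hψL2.const_smul _).add (hsL2.const_smul _)
  exact (hUL2.ae_eq (huU.symm.aeEq_restrict measurableSet_Ioi)).mono_measure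
    (Measure.restrict_mono (Ioi_subset_Ioi zero_le_one) le_rfl)

namespace InLinkDomain

theorem eq_zero_of_isLimitPointAtInfinity (hLP : IsLimitPointAtInfinity V)
    (hQ : LocallyIntegrable ((Ioi 0).indicator V)) (hz : z.im ≠ 0)
    (hs : InLinkDomain ⊤ ((Ioi 0).indicator V) ω s s' (z • s)) (hs0 : s 0 = 0) : s = 0 := by
  obtain ⟨ψ, ψ', hψ, hψ0⟩ := exists_weyl_solution EReal.zero_lt_top hQ hz ω
  have hs0' : s' 0 = 0 := by
    by_contra hs0'
    have hψL2 := hψ.memLp_fst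
    have hsL2 := hs.memLp_fst
    rw [link_top] at hψL2 hsL2
    exact hLP (isLimitCircleAtInfinity_of_memLp hQ hψ.solvesOn hs.solvesOn hψ0 hs0 hs0' hψL2 hsL2)
  exact funext fun x =>
    (hs.solvesOn.eq_zero_of_homogeneous ordConnected_univ hQ (mem_univ 0) hs0 hs0' x trivial).1

lemma sq_im_mul_integral_norm_sq_le (hLP : IsLimitPointAtInfinity V)
    (hQ : LocallyIntegrable ((Ioi 0).indicator V))
    (hu : InLinkDomain ⊤ ((Ioi 0).indicator V) ω u w F) (hu0 : u 0 = 0) (hz : z.im ≠ 0) :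
    z.im ^ 2 * ∫ t in Ioi 0, ‖u t‖ ^ 2 ≤ ∫ t in Ioi 0, ‖F t - z * u t‖ ^ 2 := by
  obtain ⟨r, r', hr, hr0, hle⟩ := exists_inLinkDomain_resolvent EReal.zero_lt_top hQ hz
    (hu.locallyIntegrable.sub (hu.solvesOn.continuous.const_smul z).locallyIntegrable)
    (hu.memLp_rhs.sub (hu.memLp_fst.const_smul z)) ω
  have hdiff := hu.sub hr
  rw [show F - (z • r + (F - z • u)) = z • (u - r) by rw [smul_sub]; abel] at hdiff
  have hur : u = r := sub_eq_zero.1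
    (hdiff.eq_zero_of_isLimitPointAtInfinity hLP hQ hz (by simp [hu0, hr0]))
  rwa [← hur, link_top] at hle

/-- The resolvent bound along the imaginary axis shows `2 y ∫ Im (F ū) ≤ ∫ ‖F‖²` for all real
`y ≠ 0`. -/
theorem integral_im_mul_conj_eq_zero (hLP : IsLimitPointAtInfinity V)
    (hQ : LocallyIntegrable ((Ioi 0).indicator V))
    (hu : InLinkDomain ⊤ ((Ioi 0).indicator V) ω u w F) (hu0 : u 0 = 0) :
    ∫ t in Ioi 0, (F t * conj (u t)).im = 0 := by
  have huL2 := hu.memLp_fst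
  have hFL2 := hu.memLp_rhs
  rw [link_top] at huL2 hFL2
  set J := ∫ t in Ioi 0, (F t * conj (u t)).im
  have hle : ∀ y : ℝ, y ≠ 0 → 2 * y * J ≤ ∫ t in Ioi 0, ‖F t‖ ^ 2 := fun y hy => by
    have hbound := hu.sq_im_mul_integral_norm_sq_le (z := y * Complex.I) hLP hQ hu0 (by simpa)
    have hexpand : ∀ t, ‖F t - y * Complex.I * u t‖ ^ 2 =
        ‖F t‖ ^ 2 + y ^ 2 * ‖u t‖ ^ 2 - 2 * y * (F t * conj (u t)).im := fun t => by
      simpa using norm_sub_mul_sq (y * Complex.I) (u t) (F t)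
    have hF := hFL2.integrable_norm_pow two_ne_zero
    have hu' := (huL2.integrable_norm_pow two_ne_zero).const_mul (y ^ 2)
    simp only [hexpand] at hbound
    have hFu : Integrable (fun t => ‖F t‖ ^ 2 + y ^ 2 * ‖u t‖ ^ 2) (volume.restrict (Ioi 0)) :=
      hF.add hu'
    rw [integral_sub hFu ((integrable_im_mul_conj hFL2 huL2).const_mul _),
      integral_add hF hu', integral_const_mul, integral_const_mul] at hbound
    simp only [Complex.im_ofReal_mul, Complex.I_im, mul_one] at hbound
    linarith
  by_contra hJ
  have hpos : 0 < (∫ t in Ioi 0, ‖F t‖ ^ 2) + 1 := by positivity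
  have hcontra := hle (((∫ t in Ioi 0, ‖F t‖ ^ 2) + 1) / (2 * J))
    (div_ne_zero hpos.ne' (mul_ne_zero two_ne_zero hJ))
  field_simp at hcontra
  linarith

end InLinkDomain

end LimitPoint

section Energy

variable {ℓ : EReal} {V : ℝ → ℝ} {ω : ℝ} {z : ℂ} {u w F : ℝ → ℂ}

lemma integral_Ioi_eq_intervalIntegral_add {E : Type*} [NormedAddCommGroup E] [NormedSpace ℝ E]
    {f : ℝ → E} {a b : ℝ} (hf : IntegrableOn f (Ioi a)) (hb : a ≤ b) :
    ∫ t in Ioi a, f t = (∫ t in a..b, f t) + ∫ t in Ioi b, f t := by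
  rw [intervalIntegral.integral_of_le hb, ← setIntegral_union Ioc_disjoint_Ioi_same
    measurableSet_Ioi (hf.mono_set Ioc_subset_Ioi_self) (hf.mono_set (Ioi_subset_Ioi hb)),
    Ioc_union_Ioi_eq_Ioi hb]

namespace InLinkDomain

/-- Subtracting `u 0` times a function supported near the vertex reduces the claim to functions
vanishing at the vertex, without changing anything near infinity. -/
theorem integral_Ioi_im_mul_conj (hLP : IsLimitPointAtInfinity V)
    (hQ : LocallyIntegrable ((Ioi 0).indicator V))
    (hu : InLinkDomain ⊤ ((Ioi 0).indicator V) ω u w F) :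
    ∫ t in Ioi 0, (F t * conj (u t)).im = -(u 0 * conj (w 0)).im := by
  obtain ⟨g, g', h, hg, hg0, hgb⟩ :=
    exists_inLinkDomain_eq_zero_of_le (ℓ := ⊤) hQ (b := 1) (by simp [link]) ω
  have hv := hu.sub (hg.smul (u 0))
  have hv0 : (u - u 0 • g) 0 = 0 := by simp [hg0]
  have hform : ∀ {v y G}, InLinkDomain ⊤ ((Ioi 0).indicator V) ω v y G →
      ∫ t in Ioi 0, (G t * conj (v t)).im = (v 1 * conj (y 1)).im - (v 0 * conj (y 0)).im +
        ∫ t in Ioi 1, (G t * conj (v t)).im := fun {v y G} hv => by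
    have hint := integrable_im_mul_conj hv.memLp_rhs hv.memLp_fst
    rw [link_top] at hint
    rw [integral_Ioi_eq_intervalIntegral_add hint zero_le_one,
      hv.solvesOn.integral_im_mul_conj hv.locallyIntegrable]
  have htail : ∫ t in Ioi 1, ((F - u 0 • h) t * conj ((u - u 0 • g) t)).im =
      ∫ t in Ioi 1, (F t * conj (u t)).im :=
    setIntegral_congr_fun measurableSet_Ioi fun t ht => by simp [hgb t (le_of_lt ht)]
  have henergy := hv.integral_im_mul_conj_eq_zero hLP hQ hv0
  rw [hform hv, htail, hv0, zero_mul, Complex.zero_im, sub_zero] at henergy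
  have hone : ((u - u 0 • g) 1 * conj ((w - u 0 • g') 1)).im = (u 1 * conj (w 1)).im := by
    simp [hgb 1 le_rfl]
  rw [hform hu]
  linarith

theorem integral_link_im_mul_conj (hℓ : 0 < ℓ) (hLP : ℓ = ⊤ → IsLimitPointAtInfinity V)
    (hQ : LocallyIntegrable ((link ℓ).indicator V))
    (hu : InLinkDomain ℓ ((link ℓ).indicator V) ω u w F) :
    ∫ t in link ℓ, (F t * conj (u t)).im = -(u 0 * conj (w 0)).im := by
  induction ℓ using EReal.rec with
  | bot => exact absurd hℓ not_lt_bot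
  | coe L =>
    have henergy := hu.solvesOn.integral_im_mul_conj hu.locallyIntegrable 0 L
    rw [im_mul_conj_eq_zero_of_mul_cos_add_mul_sin (hu.end_condition L rfl), zero_sub,
      intervalIntegral.integral_of_le (EReal.coe_pos.1 hℓ).le,
      Measure.restrict_congr_set Ioo_ae_eq_Ioc.symm, ← link_coe] at henergy
    exact henergy
  | top =>
    rw [link_top] at hQ hu ⊢
    exact hu.integral_Ioi_im_mul_conj (hLP rfl) hQ

lemma integral_link_norm_sq_pos (hℓ : 0 < ℓ) {Q : ℝ → ℝ} (hu : InLinkDomain ℓ Q ω u w F)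
    (hu0 : u 0 ≠ 0) : 0 < ∫ t in link ℓ, ‖u t‖ ^ 2 := by
  obtain ⟨b, hb, hbℓ⟩ := EReal.lt_iff_exists_real_btwn.1 hℓ
  have hb0 : 0 < b := EReal.coe_pos.1 hb
  refine (hu.solvesOn.integral_norm_sq_pos (.inl hu0) hb0).trans_le ?_
  rw [intervalIntegral.integral_of_le hb0.le]
  refine setIntegral_mono_set (hu.memLp_fst.integrable_norm_pow two_ne_zero)
    (.of_forall fun t => by positivity) (LE.le.eventuallyLE fun x hx => ?_)
  exact ⟨hx.1, (EReal.coe_le_coe_iff.2 hx.2).trans_lt hbℓ⟩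

theorem im_deriv_mul_im_pos (hℓ : 0 < ℓ) (hLP : ℓ = ⊤ → IsLimitPointAtInfinity V)
    (hQ : LocallyIntegrable ((link ℓ).indicator V)) (hz : z.im ≠ 0)
    (hψ : InLinkDomain ℓ ((link ℓ).indicator V) ω u w (z • u)) (hψ0 : u 0 = 1) :
    0 < (w 0).im * z.im := by
  have henergy := hψ.integral_link_im_mul_conj hℓ hLP hQ
  have him : ∀ t, ((z • u) t * conj (u t)).im = z.im * ‖u t‖ ^ 2 := fun t => by
    rw [Pi.smul_apply, smul_eq_mul, mul_assoc, Complex.mul_conj']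
    norm_cast
    rw [Complex.im_mul_ofReal]
  simp only [him, hψ0, one_mul, Complex.conj_im, neg_neg, integral_const_mul] at henergy
  have hpos := hψ.integral_link_norm_sq_pos hℓ (hψ0.trans_ne one_ne_zero)
  rw [← henergy, mul_right_comm]
  exact mul_pos (mul_self_pos.2 hz) hpos

end InLinkDomain

end Energy

/-! ### A criterion for self-adjointness -/

section Criterion

variable {E : Type*} [NormedAddCommGroup E] [InnerProductSpace ℂ E]

lemma le_adjoint_of_forall_im_inner_eq_zero {S : Submodule ℂ (E × E)}
    (h : ∀ p ∈ S, (inner ℂ p.1 p.2).im = 0) : S ≤ S.adjoint := by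
  rintro ⟨x, y⟩ hxy
  refine (Submodule.mem_adjoint_iff S (x, y)).2 fun a b hab => ?_
  have hdiag : ∀ p ∈ S, inner ℂ p.2 p.1 = inner ℂ p.1 p.2 := fun p hp => by
    rw [← inner_conj_symm, Complex.conj_eq_iff_im.2 (h p hp)]
  have hxx := hdiag _ hxy
  have haa := hdiag _ hab
  have hadd := hdiag _ (S.add_mem hab hxy)
  have haddI := hdiag _ (S.add_mem hab (S.smul_mem Complex.I hxy))
  simp only [Prod.fst_add, Prod.snd_add, Prod.smul_fst, Prod.smul_snd, inner_add_left,
    inner_add_right, inner_smul_left, inner_smul_right, Complex.conj_I] at hxx haa hadd haddI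
  have hsum : inner ℂ b x - inner ℂ a y + (inner ℂ y a - inner ℂ x b) = 0 := by
    linear_combination hadd - haa - hxx
  have hdiff : inner ℂ b x - inner ℂ a y - (inner ℂ y a - inner ℂ x b) = 0 :=
    (mul_eq_zero.1 (by linear_combination haddI - haa + Complex.I * Complex.I * hxx :
      Complex.I * (inner ℂ b x - inner ℂ a y - (inner ℂ y a - inner ℂ x b)) = 0)).resolve_left
      Complex.I_ne_zero
  linear_combination (hsum + hdiff) / 2

theorem adjoint_le_of_forall_exists_snd_eq {S : Submodule ℂ (E × E)} (hS : S ≤ S.adjoint) (z : ℂ)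
    (h : ∀ f, ∃ p ∈ S, p.2 = z • p.1 + f) (h' : ∀ f, ∃ p ∈ S, p.2 = conj z • p.1 + f) :
    S.adjoint ≤ S := by
  rintro ⟨x, y⟩ hxy
  obtain ⟨⟨a, b⟩, hab, rfl : b = z • a + (y - z • x)⟩ := h (y - z • x)
  obtain ⟨⟨c, d⟩, hcd, rfl : d = conj z • c + (x - a)⟩ := h' (x - a)
  have hx := (Submodule.mem_adjoint_iff S _).1 hxy _ _ hcd
  have ha := (Submodule.mem_adjoint_iff S _).1 (hS hab) _ _ hcd
  have hax : inner ℂ (x - a) (x - a) = 0 := by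
    simp only [inner_add_left, inner_add_right, inner_sub_left, inner_sub_right, inner_smul_left,
      inner_smul_right, Complex.conj_conj] at hx ha ⊢
    linear_combination hx - ha
  obtain rfl : x = a := sub_eq_zero.1 (inner_self_eq_zero.1 hax)
  simpa using hab

theorem isSelfAdjoint_of_adjoint_graph_eq [CompleteSpace E] {A : E →ₗ.[ℂ] E}
    (h : A.graph.adjoint = A.graph) : IsSelfAdjoint A := by
  have hdense : Dense (A.domain : Set E) := by
    rw [Submodule.dense_iff_topologicalClosure_eq_top, Submodule.topologicalClosure_eq_top_iff,
      Submodule.eq_bot_iff]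
    intro x hx
    have hmem : (0, x) ∈ A.graph := by
      rw [← h]
      refine (Submodule.mem_adjoint_iff _ _).2 fun a b hab => ?_
      rw [inner_zero_right, (Submodule.mem_orthogonal _ _).1 hx a (A.mem_domain_of_mem_graph hab),
        sub_zero]
    exact A.graph_fst_eq_zero_snd hmem rfl
  exact (LinearPMap.isSelfAdjoint_def).2
    (LinearPMap.eq_of_eq_graph ((A.adjoint_graph_eq_graph_adjoint hdense).trans h))

end Criterion

/-! ### The star graph -/

section Representatives

variable {ℓ : EReal} {V : ℝ → ℝ} {ω : ℝ} {u w f : ℝ → ℂ}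

lemma ordConnected_link (ℓ : EReal) : (link ℓ).OrdConnected :=
  ⟨fun _ hx _ hy _ ht =>
    ⟨hx.1.trans_le ht.1, (EReal.coe_le_coe_iff.2 ht.2).trans_lt hy.2⟩⟩

lemma link_mem_nhdsGT (hℓ : 0 < ℓ) : link ℓ ∈ 𝓝[>] 0 := by
  obtain ⟨b, hb, hbℓ⟩ := EReal.lt_iff_exists_real_btwn.1 hℓ
  exact mem_of_superset (Ioo_mem_nhdsGT (EReal.coe_pos.1 hb))
    fun x hx => ⟨hx.1, (EReal.coe_lt_coe_iff.2 hx.2).trans hbℓ⟩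

lemma link_mem_nhdsLT {L : ℝ} (hL : 0 < L) : link L ∈ 𝓝[<] L :=
  link_coe L ▸ Ioo_mem_nhdsLT hL

lemma isClosed_closedLink (ℓ : EReal) : IsClosed (closedLink ℓ) :=
  (isClosed_le continuous_const continuous_id).inter
    (isClosed_le continuous_coe_real_ereal continuous_const)

lemma locallyIntegrable_indicator_link (hV : LocallyIntegrableOn V (closedLink ℓ)) :
    LocallyIntegrable ((link ℓ).indicator V) := by
  refine locallyIntegrable_iff.2 fun K hK => ?_
  have hVK : IntegrableOn V (closedLink ℓ ∩ K) := hV.integrableOn_compact_subset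
    inter_subset_left (hK.inter_left (isClosed_closedLink ℓ))
  have hm := measurableSet_link ℓ
  rw [IntegrableOn, integrable_indicator_iff hm, IntegrableOn, Measure.restrict_restrict hm]
  exact hVK.mono_set (inter_subset_inter_left _ fun x hx => ⟨hx.1.le, hx.2.le⟩)

lemma eq_of_eqOn_of_tendsto {X Y : Type*} [TopologicalSpace X] [TopologicalSpace Y]
    [T2Space Y] {g h : X → Y} (hg : Continuous g) {l : Filter X} [l.NeBot] {I : Set X} {x : X}
    {c : Y} (hl : l ≤ 𝓝 x) (hI : I ∈ l) (hgh : EqOn g h I) (hh : Tendsto h l (𝓝 c)) : g x = c :=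
  tendsto_nhds_unique ((hg.tendsto x).mono_left hl) (hh.congr' (hgh.symm.eventuallyEq_of_mem hI))

theorem exists_inLinkDomain_extension (hℓ : 0 < ℓ) (hV : LocallyIntegrableOn V (closedLink ℓ))
    (h : SolvesOn (link ℓ) V u w f) (huL2 : MemLp u 2 (volume.restrict (link ℓ)))
    (hfL2 : MemLp f 2 (volume.restrict (link ℓ)))
    (hend : ∀ L : ℝ, ℓ = L → ∃ c d : ℂ, Tendsto u (𝓝[<] L) (𝓝 c) ∧ Tendsto w (𝓝[<] L) (𝓝 d) ∧
      c * Real.cos ω + d * Real.sin ω = 0) :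
    ∃ U W, InLinkDomain ℓ ((link ℓ).indicator V) ω U W ((link ℓ).indicator f) ∧
      EqOn U u (link ℓ) ∧ EqOn W w (link ℓ) := by
  obtain ⟨b, hb, hbℓ⟩ := EReal.lt_iff_exists_real_btwn.1 hℓ
  have hm := measurableSet_link ℓ
  have hfL2' : MemLp ((link ℓ).indicator f) 2 := (memLp_indicator_iff_restrict hm).2 hfL2
  have hfint := hfL2'.locallyIntegrable one_le_two
  obtain ⟨U, W, hUW, hU, hW⟩ := h.exists_extension (ordConnected_link ℓ) ⟨EReal.coe_pos.1 hb, hbℓ⟩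
    (locallyIntegrable_indicator_link hV) hfint
  refine ⟨U, W, ⟨hUW, hfint, huL2.ae_eq (hU.symm.aeEq_restrict hm), hfL2'.restrict _, ?_⟩, hU, hW⟩
  rintro L rfl
  obtain ⟨c, d, hc, hd, hcd⟩ := hend L rfl
  have hL := link_mem_nhdsLT (EReal.coe_pos.1 hℓ)
  rwa [eq_of_eqOn_of_tendsto hUW.continuous nhdsWithin_le_nhds hL hU hc,
    eq_of_eqOn_of_tendsto hUW.continuous_deriv nhdsWithin_le_nhds hL hW hd]

end Representatives

section VertexRelation

variable {ι : Type*} [Fintype ι] {α : OnePoint ℝ}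

/-- The vertex condition as a relation between the values `c j` of the wave function and the values
`d j` of its derivative at the vertex. -/
def VertexRelation (α : OnePoint ℝ) (c d : ι → ℂ) : Prop :=
  (∀ a : ℝ, α = a → ∃ e : ℂ, (∀ j, c j = e) ∧ ∑ j, d j = a * e) ∧
    (α = OnePoint.infty → ∀ j, c j = 0)

lemma VertexRelation.sum_im_mul_conj_eq_zero {c d : ι → ℂ} (h : VertexRelation α c d) :
    ∑ j, (c j * conj (d j)).im = 0 := by
  induction α using OnePoint.rec with
  | infty => simp [h.2 rfl]
  | coe a =>
    obtain ⟨e, hc, hd⟩ := h.1 a rfl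
    rw [← Complex.im_sum]
    simp only [hc]
    rw [← Finset.mul_sum, ← map_sum, hd, map_mul, Complex.conj_ofReal, mul_left_comm,
      Complex.mul_conj', Complex.im_ofReal_mul]
    norm_cast
    simp

/-- For `α = a ∈ ℝ` the equation for `k` is `∑ d j + k ∑ m j = a k`, solvable because `∑ m j` is
not real. -/
lemma exists_vertexRelation_add_smul {d m : ι → ℂ} {y : ℝ} (hm : ∀ j, 0 < (m j).im * y) :
    ∃ k : ℂ, VertexRelation α (fun _ => k) (d + k • m) := by
  induction α using OnePoint.rec with
  | infty => exact ⟨0, fun a ha => absurd ha (OnePoint.infty_ne_coe a), fun _ _ => rfl⟩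
  | coe a =>
    rcases isEmpty_or_nonempty ι with hι | hι
    · exact ⟨0, fun b _ => ⟨0, isEmptyElim, by simp⟩, fun h => absurd h (OnePoint.coe_ne_infty a)⟩
    have hne : (a : ℂ) - ∑ j, m j ≠ 0 := fun h => by
      have hsum : 0 < (∑ j, m j).im * y := by
        rw [Complex.im_sum, Finset.sum_mul]
        exact Finset.sum_pos (fun j _ => hm j) Finset.univ_nonempty
      rw [← sub_eq_zero.1 h, Complex.ofReal_im, zero_mul] at hsum
      exact hsum.false
    refine ⟨(∑ j, d j) / (a - ∑ j, m j), fun b hb => ⟨_, fun _ => rfl, ?_⟩,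
      fun h => absurd h (OnePoint.coe_ne_infty a)⟩
    obtain rfl : a = b := OnePoint.coe_injective hb
    simp only [Pi.add_apply, Pi.smul_apply, smul_eq_mul, Finset.sum_add_distrib, ← Finset.mul_sum]
    field_simp
    ring

end VertexRelation

section Star

variable {N : ℕ} {ℓ : Fin N → EReal} {V : Fin N → ℝ → ℝ} {ω : Fin N → ℝ} {α : OnePoint ℝ}
  {p : StateSpace ℓ × StateSpace ℓ}

theorem exists_inLinkDomain_of_mem_hamiltonianGraph (hℓ : ∀ j, 0 < ℓ j)
    (hV : ∀ j, LocallyIntegrableOn (V j) (closedLink (ℓ j))) (hp : p ∈ hamiltonianGraph ℓ V ω α) :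
    ∃ u w F : Fin N → ℝ → ℂ,
      (∀ j, InLinkDomain (ℓ j) ((link (ℓ j)).indicator (V j)) (ω j) (u j) (w j) (F j)) ∧
      (∀ j, p.1 j =ᵐ[volume.restrict (link (ℓ j))] u j) ∧
      (∀ j, p.2 j =ᵐ[volume.restrict (link (ℓ j))] F j) ∧
      VertexRelation α (fun j => u j 0) (fun j => w j 0) := by
  obtain ⟨u, w, hpu, hsol, hvertex, hend⟩ := hp
  choose U W hUW hU hW using fun j => exists_inLinkDomain_extension (hℓ j) (hV j) (hsol j)
    ((Lp.memLp (p.1 j)).ae_eq (hpu j)) (Lp.memLp (p.2 j)) (hend j)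
  have hm := fun j => measurableSet_link (ℓ j)
  have hvalue : ∀ {j c}, Tendsto (u j) (𝓝[>] 0) (𝓝 c) → U j 0 = c := fun {j c} hc =>
    eq_of_eqOn_of_tendsto (hUW j).solvesOn.continuous nhdsWithin_le_nhds
      (link_mem_nhdsGT (hℓ j)) (hU j) hc
  have hderiv : ∀ {j d}, Tendsto (w j) (𝓝[>] 0) (𝓝 d) → W j 0 = d := fun {j d} hd =>
    eq_of_eqOn_of_tendsto (hUW j).solvesOn.continuous_deriv nhdsWithin_le_nhds
      (link_mem_nhdsGT (hℓ j)) (hW j) hd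
  refine ⟨U, W, _, hUW, fun j => (hpu j).trans ((hU j).symm.aeEq_restrict (hm j)),
    fun j => (indicator_ae_eq_restrict (hm j)).symm, fun a ha => ?_,
    fun ha j => hvalue (hvertex.2 ha j)⟩
  obtain ⟨c, d, hc, hd, hsum⟩ := hvertex.1 a ha
  exact ⟨c, fun j => hvalue (hc j), by simp only [hderiv (hd _), hsum]⟩

theorem mem_hamiltonianGraph_of_inLinkDomain {u w F : Fin N → ℝ → ℂ}
    (h : ∀ j, InLinkDomain (ℓ j) ((link (ℓ j)).indicator (V j)) (ω j) (u j) (w j) (F j))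
    (hpu : ∀ j, p.1 j =ᵐ[volume.restrict (link (ℓ j))] u j)
    (hpF : ∀ j, p.2 j =ᵐ[volume.restrict (link (ℓ j))] F j)
    (hvertex : VertexRelation α (fun j => u j 0) (fun j => w j 0)) :
    p ∈ hamiltonianGraph ℓ V ω α := by
  have hu : ∀ j x, Tendsto (u j) (𝓝 x) (𝓝 (u j x)) := fun j x =>
    (h j).solvesOn.continuous.tendsto x
  have hw : ∀ j x, Tendsto (w j) (𝓝 x) (𝓝 (w j x)) := fun j x =>
    (h j).solvesOn.continuous_deriv.tendsto x
  refine ⟨u, w, hpu, fun j => ?_, ⟨fun a ha => ?_, fun ha j => ?_⟩, fun j L hL => ?_⟩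
  · exact ((h j).solvesOn.restrict (measurableSet_link _) (subset_univ _)
      fun x hx => indicator_of_mem hx (V j)).congr (hpF j)
  · obtain ⟨c, hc, hd⟩ := hvertex.1 a ha
    exact ⟨c, fun j => w j 0, fun j => hc j ▸ (hu j 0).mono_left nhdsWithin_le_nhds,
      fun j => (hw j 0).mono_left nhdsWithin_le_nhds, hd⟩
  · exact hvertex.2 ha j ▸ (hu j 0).mono_left nhdsWithin_le_nhds
  · exact ⟨u j L, w j L, (hu j L).mono_left nhdsWithin_le_nhds,
      (hw j L).mono_left nhdsWithin_le_nhds, (h j).end_condition L hL⟩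

theorem im_inner_eq_zero_of_mem_hamiltonianGraph (hℓ : ∀ j, 0 < ℓ j)
    (hV : ∀ j, LocallyIntegrableOn (V j) (closedLink (ℓ j)))
    (hLP : ∀ j, ℓ j = ⊤ → IsLimitPointAtInfinity (V j)) (hp : p ∈ hamiltonianGraph ℓ V ω α) :
    (inner ℂ p.1 p.2).im = 0 := by
  obtain ⟨u, w, F, hu, hpu, hpF, hvertex⟩ := exists_inLinkDomain_of_mem_hamiltonianGraph hℓ hV hp
  have hlink : ∀ j, (inner ℂ (p.1 j) (p.2 j)).im = -(u j 0 * conj (w j 0)).im := fun j => by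
    rw [← (hu j).integral_link_im_mul_conj (hℓ j) (hLP j)
        (locallyIntegrable_indicator_link (hV j)), L2.inner_def]
    refine (integral_im (L2.integrable_inner (𝕜 := ℂ) (p.1 j) (p.2 j))).symm.trans
      (integral_congr_ae ?_)
    filter_upwards [hpu j, hpF j] with x hux hFx
    rw [hux, hFx]
    rfl
  rw [PiLp.inner_apply, Complex.im_sum, Finset.sum_congr rfl fun j _ => hlink j,
    Finset.sum_neg_distrib, hvertex.sum_im_mul_conj_eq_zero, neg_zero]

theorem exists_mem_hamiltonianGraph_snd_eq (hℓ : ∀ j, 0 < ℓ j)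
    (hV : ∀ j, LocallyIntegrableOn (V j) (closedLink (ℓ j)))
    (hLP : ∀ j, ℓ j = ⊤ → IsLimitPointAtInfinity (V j)) {z : ℂ} (hz : z.im ≠ 0)
    (f : StateSpace ℓ) : ∃ p ∈ hamiltonianGraph ℓ V ω α, p.2 = z • p.1 + f := by
  have hm := fun j => measurableSet_link (ℓ j)
  have hQ := fun j => locallyIntegrable_indicator_link (hV j)
  have hfL2 := fun j => (memLp_indicator_iff_restrict (hm j)).2 (Lp.memLp (f j))
  choose r r' hr hr0 _ using fun j => exists_inLinkDomain_resolvent (hℓ j) (hQ j) hz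
    ((hfL2 j).locallyIntegrable one_le_two) ((hfL2 j).restrict _) (ω j)
  choose ψ ψ' hψ hψ0 using fun j => exists_weyl_solution (hℓ j) (hQ j) hz (ω j)
  obtain ⟨k, hk⟩ := exists_vertexRelation_add_smul (α := α) (d := fun j => r' j 0) fun j =>
    (hψ j).im_deriv_mul_im_pos (hℓ j) (hLP j) (hQ j) hz (hψ0 j)
  have hu := fun j => (hr j).add ((hψ j).smul k)
  let x : StateSpace ℓ := WithLp.toLp 2 fun j => (hu j).memLp_fst.toLp
  have hx : ∀ j, x j =ᵐ[volume.restrict (link (ℓ j))] r j + k • ψ j := fun j =>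
    (hu j).memLp_fst.coeFn_toLp
  refine ⟨(x, z • x + f), mem_hamiltonianGraph_of_inLinkDomain hu hx (fun j => ?_) ?_, rfl⟩
  · refine (Lp.coeFn_add (z • x j) (f j)).trans ?_
    filter_upwards [Lp.coeFn_smul z (x j), hx j, indicator_ae_eq_restrict (f := f j) (hm j)]
      with t hzx hxt hft
    simp only [Pi.add_apply, Pi.smul_apply, smul_eq_mul] at hzx hxt ⊢
    rw [hzx, hxt, hft]
    ring
  · simp only [Pi.add_apply, Pi.smul_apply, hr0, hψ0, smul_eq_mul, mul_one, zero_add]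
    exact hk

end Star

end StarGraph

theorem mainTheorem5_general (N : ℕ) (ℓ : Fin N → EReal) (hℓ : ∀ j, 0 < ℓ j)
    (V : Fin N → ℝ → ℝ)
    (hV : ∀ j, LocallyIntegrableOn (V j) (StarGraph.closedLink (ℓ j)))
    (hLP : ∀ j, ℓ j = ⊤ → StarGraph.IsLimitPointAtInfinity (V j))
    (ω : Fin N → ℝ) (α : OnePoint ℝ) :
    IsSelfAdjoint (StarGraph.hamiltonian ℓ V ω α) := by
  have hsymm := StarGraph.le_adjoint_of_forall_im_inner_eq_zero fun _ =>
    StarGraph.im_inner_eq_zero_of_mem_hamiltonianGraph (ω := ω) (α := α) hℓ hV hLP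
  have hsurj {z : ℂ} (hz : z.im ≠ 0) :=
    StarGraph.exists_mem_hamiltonianGraph_snd_eq (ω := ω) (α := α) hℓ hV hLP hz
  apply StarGraph.isSelfAdjoint_of_adjoint_graph_eq
  rw [StarGraph.hamiltonian_graph]
  exact (StarGraph.adjoint_le_of_forall_exists_snd_eq hsymm Complex.I
    (hsurj (by simp)) (hsurj (by simp))).antisymm hsymm

/-- Self-adjointness of the Schrödinger operator `H_α(V)` on a star graph. -/
theorem mainTheorem5 (N : ℕ) (hN : 2 ≤ N)
    (ℓ : Fin N → EReal) (hℓ : ∀ j, 0 < ℓ j)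
    (V : Fin N → ℝ → ℝ)
    (hV : ∀ j, LocallyIntegrableOn (V j) (StarGraph.closedLink (ℓ j)))
    (hLP : ∀ j, ℓ j = ⊤ → StarGraph.IsLimitPointAtInfinity (V j))
    (ω : Fin N → ℝ) (α : OnePoint ℝ) :
    IsSelfAdjoint (StarGraph.hamiltonian ℓ V ω α) :=
  mainTheorem5_general N ℓ hℓ V hV hLP ω α
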